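/- **Theorem 4.1 (forward error of one sweep).** Let $u\ge 0$ be the unit roundoff. Floating point arithmetic follows the standard model: every operation $+,-,\times,/$ on real or complex numbers, and every real square root, returns its exact result times $1+\delta$, with its own $|\delta|\le u$ ($\delta$ real for real operations, complex for complex ones); negation and conjugation are exact, and $|z|^2$ is computed as $(\mathrm{Re}\,z)^2+(\mathrm{Im}\,z)^2$. Norms are the Euclidean norm of vectors and the Frobenius norm of matrices; $v_k^*=\overline{v_k}$ for an entry of a vector $v$. For $x\in\mathbb C^2$ let $$Q(x)=\begin{pmatrix} c&-s\\ \bar s&\bar c\end{pmatrix}\in \mathrm{SU}(2),\qquad c=\frac{x_2}{\|x\|},\quad s=\frac{x_1}{\|x\|}\qquad (c=1,\ s=0\ \text{ if } x=0),$$ so that $(Q(x)x)_1=0$. Its computed version has the same form with computed $c$ and $s$. Let $A\in\mathbb C^{n\times n}$ be Hermitian with diagonal $d$ and superdiagonal $\beta$, and let $p,q\in\mathbb C^n$ be such that $A+pq^*$ is lower Hessenberg (its entries $(i,j)$ with $j>i+1$ vanish). *Algorithm 1* (elimination of the superdiagonal). Set $\gamma\gets\overline\beta$ and $\tilde q\gets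 q$. For $k=n,n-1,\dots,2$: 1. form $x=(\beta_{k-1}+p_{k-1}q_k^*,\ d_k+p_kq_k^*)^T$ and construct the rotation $Q_k$ that eliminates its first entry; 2. if $k\neq2$, set $\gamma_{k-2}\gets\big(Q_k(\gamma_{k-2},-\tilde q_k p_{k-2}^*)^T\big)_1$; 3. multiply $(d_{k-1},\gamma_{k-1})^T$, then $(\beta_{k-1},d_k)^T$, then $(p_{k-1},p_k)^T$ by $Q_k$; 4. if $|p_{k-1}q_k^*|^2+|p_kq_k^*|^2>|\beta_{k-1}|^2+|d_k|^2$, set $p_{k-1}\gets-\beta_{k-1}/q_k^*$; 5. multiply $(\tilde q_{k-1},\tilde q_k)^T$ by $Q_k$. The outputs are the rotations $Q_k$ and $d,\gamma,p$. *Algorithm 2* (rotation back to Hessenberg form), applied to the outputs $Q_k,d,\gamma,p$ of Algorithm 1 and to the original $q$. For $k=n,n-1,\dots,2$: 1. $(d_{k-1},\beta_{k-1})^T\gets\overline{Q_k}\,(d_{k-1},-p_{k-1}q_k^*)^T$; 2. $d_k\gets\big(\overline{Q_k}\,(\gamma_{k-1},d_k)^T\big)_2$; 3. $(q_{k-1},q_k)^T\gets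 Q_k(q_{k-1},q_k)^T$. The outputs are $d,\beta,q$. Carry out both algorithms in floating point arithmetic. Let $\hat p$ be the vector $p$ returned by Algorithm 1, let $\hat d,\hat\beta,\hat q$ be the outputs of Algorithm 2, and define $\hat A\in\mathbb C^{n\times n}$ by $$\hat a_{i,j}=\begin{cases}-\hat p_i\hat q_j^* & j>i+1,\\ \hat\beta_i & j=i+1,\\ \hat d_i & j=i,\\ \overline{\hat\beta_j} & j=i-1,\\ -\hat q_i\hat p_j^* & j<i-1.\end{cases}$$ For $k=2,\dots,n$ let $\hat x_k\in\mathbb C^2$ be the vector actually computed in step 1 of Algorithm 1, let $U_k$ be the $n\times n$ matrix that applies the exact rotation $Q(\hat x_k)$ in the $(k-1,k)$-plane and is the identity elsewhere, and let $U=U_2U_3\cdots U_n$. Then there is an absolute constant $K>0$ (independent of $n,u,A,p,q$ and of the rounding errors) such that, whenever $Kn^3u\le1$, $$\|\hat A-UAU^*\|\le Kn^3\,\|A\|\,u,\qquad \|\hat p-Up\|\le Kn^3\,\|p\|\,u,\qquad \|\hat q-Uq\|\le Kn^3\,\|q\|\,u .$$ -/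

import Mathlib

open scoped Matrix ComplexConjugate Matrix.Norms.Frobenius

namespace HermRankOneQR

/-! ### Floating point arithmetic -/

/-- The standard model of floating point arithmetic with unit roundoff `u`: `y` is an admissible
computed value of an elementary operation whose exact result is `x`, i.e. `y = x * (1 + δ)` for
some `δ` (in `𝕜 = ℝ` or `ℂ`) with `|δ| ≤ u`. Each operation has its own `δ`. Negation and complex
conjugation are exact. -/
def Fl {𝕜 : Type} [RCLike 𝕜] (u : ℝ) (x y : 𝕜) : Prop :=
  ∃ δ : 𝕜, ‖δ‖ ≤ u ∧ y = x * (1 + δ)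

/-- `z` is a computed value of `a * x + b * y`. -/
def FlDot (u : ℝ) (a b x y z : ℂ) : Prop :=
  ∃ s t : ℂ, Fl u (a * x) s ∧ Fl u (b * y) t ∧ Fl u (s + t) z

/-- `(x', y')` is a computed value of the matrix-vector product `Q * (x, y)`. -/
def FlApply (u : ℝ) (Q : Matrix (Fin 2) (Fin 2) ℂ) (x y x' y' : ℂ) : Prop :=
  FlDot u (Q 0 0) (Q 0 1) x y x' ∧ FlDot u (Q 1 0) (Q 1 1) x y y'

/-- `t` is a computed value of `|z|^2 = (re z)^2 + (im z)^2`. -/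
def FlNormSq (u : ℝ) (z : ℂ) (t : ℝ) : Prop :=
  ∃ a b : ℝ, Fl u (z.re * z.re) a ∧ Fl u (z.im * z.im) b ∧ Fl u (a + b) t

/-- `t` is a computed value of `|z|^2 + |w|^2`. -/
def FlSumSq (u : ℝ) (z w : ℂ) (t : ℝ) : Prop :=
  ∃ a b : ℝ, FlNormSq u z a ∧ FlNormSq u w b ∧ Fl u (a + b) t

/-! ### Plane rotations -/

/-- The matrix `[c, -s; conj s, conj c]`. -/
def rotMatrix (c s : ℂ) : Matrix (Fin 2) (Fin 2) ℂ :=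
  !![c, -s; conj s, conj c]

/-- The exact rotation `Q ∈ SU(2)` with `(Q x)₁ = 0`: here `c = x₂ / ‖x‖`, `s = x₁ / ‖x‖`, and
`c = 1`, `s = 0` if `x = 0`. -/
noncomputable def exactRot (x : ℂ × ℂ) : Matrix (Fin 2) (Fin 2) ℂ :=
  open Classical in
  if x = 0 then rotMatrix 1 0
  else
    rotMatrix (x.2 / (Real.sqrt (‖x.1‖ ^ 2 + ‖x.2‖ ^ 2) : ℂ))
      (x.1 / (Real.sqrt (‖x.1‖ ^ 2 + ‖x.2‖ ^ 2) : ℂ))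

/-- `Q` is a computed version of the rotation that eliminates the first entry of `x`. -/
def FlRot (u : ℝ) (x : ℂ × ℂ) (Q : Matrix (Fin 2) (Fin 2) ℂ) : Prop :=
  (x = 0 → Q = rotMatrix 1 0) ∧
  (x ≠ 0 → ∃ (t r : ℝ) (c s : ℂ), FlSumSq u x.1 x.2 t ∧ Fl u (Real.sqrt t) r ∧
    Fl u (x.2 / (r : ℂ)) c ∧ Fl u (x.1 / (r : ℂ)) s ∧ Q = rotMatrix c s)

/-- The `n × n` matrix that acts as the `2 × 2` matrix `Q` in the `(j, j+1)`-plane (coordinates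
are numbered from `0`) and as the identity on the other coordinates. -/
def planeMatrix (n j : ℕ) (Q : Matrix (Fin 2) (Fin 2) ℂ) : Matrix (Fin n) (Fin n) ℂ :=
  Matrix.of fun a b =>
    if (a : ℕ) = j ∧ (b : ℕ) = j then Q 0 0
    else if (a : ℕ) = j ∧ (b : ℕ) = j + 1 then Q 0 1
    else if (a : ℕ) = j + 1 ∧ (b : ℕ) = j then Q 1 0
    else if (a : ℕ) = j + 1 ∧ (b : ℕ) = j + 1 then Q 1 1
    else if a = b then 1 else 0

/-- The ordered product `P₀ P₁ ⋯ P_{n-2}`, where `P_j` acts as `Q j` in the `(j, j+1)`-plane. -/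
def planeProduct (n : ℕ) (Q : ℕ → Matrix (Fin 2) (Fin 2) ℂ) : Matrix (Fin n) (Fin n) ℂ :=
  ((List.range (n - 1)).map fun j => planeMatrix n j (Q j)).prod

/-! ### Generators -/

/-- All entries above the first superdiagonal vanish. -/
def IsLowerHessenberg {n : ℕ} (M : Matrix (Fin n) (Fin n) ℂ) : Prop :=
  ∀ i j : Fin n, (i : ℕ) + 1 < (j : ℕ) → M i j = 0

/-- A vector as an array indexed by `0, …, n-1` (entries outside this range are never used). -/
def arr {n : ℕ} (v : Fin n → ℂ) (i : ℕ) : ℂ :=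
  if h : i < n then v ⟨i, h⟩ else 0

/-- The array of the diagonal entries `a_{i,i}`. -/
def diagArr {n : ℕ} (A : Matrix (Fin n) (Fin n) ℂ) (i : ℕ) : ℂ :=
  if h : i < n then A ⟨i, h⟩ ⟨i, h⟩ else 0

/-- The array of the superdiagonal entries `a_{i,i+1}`. -/
def superdiagArr {n : ℕ} (A : Matrix (Fin n) (Fin n) ℂ) (i : ℕ) : ℂ :=
  if h : i + 1 < n then A ⟨i, Nat.lt_of_succ_lt h⟩ ⟨i + 1, h⟩ else 0

/-- The matrix defined by a diagonal `d`, a superdiagonal `β` and vectors `p`, `q`: its part above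
the superdiagonal is that of `-p q^*`, and its part below the diagonal is the conjugate transpose
of the part above the diagonal. -/
def generatedMatrix (n : ℕ) (d β p q : ℕ → ℂ) : Matrix (Fin n) (Fin n) ℂ :=
  Matrix.of fun i j =>
    if (i : ℕ) + 1 < (j : ℕ) then -(p i * conj (q j))
    else if (j : ℕ) = (i : ℕ) + 1 then β i
    else if (j : ℕ) = (i : ℕ) then d i
    else if (i : ℕ) = (j : ℕ) + 1 then conj (β j)
    else -(q i * conj (p j))

/-! ### Elimination of the superdiagonal, in floating point arithmetic -/

/-- The variables of the elimination: diagonal `d`, superdiagonal `β`, subdiagonal `γ`, the vector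
`p`, and the working copy `qt` of `q`. -/
structure ElimState where
  d : ℕ → ℂ
  β : ℕ → ℂ
  γ : ℕ → ℂ
  p : ℕ → ℂ
  qt : ℕ → ℂ

/-- The state before the first elimination. -/
def elimInit {n : ℕ} (A : Matrix (Fin n) (Fin n) ℂ) (p q : Fin n → ℂ) : ElimState where
  d := diagArr A
  β := superdiagArr A
  γ := fun i => conj (superdiagArr A i)
  p := arr p
  qt := arr q

/-- One pass of the loop, carried out in floating point arithmetic: the elimination of the
superdiagonal entry in position `(j, j+1)` (numbered from `0`) turns the state `s` into `s'`. Here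
`x` is the computed value of the `2`-vector whose first entry is to be eliminated, and `Q` is the
computed rotation. -/
structure ElimStep (u : ℝ) (q : ℕ → ℂ) (j : ℕ) (s s' : ElimState) (x : ℂ × ℂ)
    (Q : Matrix (Fin 2) (Fin 2) ℂ) : Prop where
  /-- `x₁ = β_j + p_j q_{j+1}^*` -/
  vec_fst : ∃ t, Fl u (s.p j * conj (q (j + 1))) t ∧ Fl u (s.β j + t) x.1
  /-- `x₂ = d_{j+1} + p_{j+1} q_{j+1}^*` -/
  vec_snd : ∃ t, Fl u (s.p (j + 1) * conj (q (j + 1))) t ∧ Fl u (s.d (j + 1) + t) x.2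
  /-- construct the rotation -/
  rot : FlRot u x Q
  /-- rotate the subdiagonal and the sub-subdiagonal, the latter being `-qt_{j+1} p_{j-1}^*` -/
  sub : 0 < j → ∃ w, Fl u (s.qt (j + 1) * conj (s.p (j - 1))) w ∧
    FlDot u (Q 0 0) (Q 0 1) (s.γ (j - 1)) (-w) (s'.γ (j - 1))
  /-- rotate the diagonal and the subdiagonal -/
  diag_sub : FlApply u Q (s.d j) (s.γ j) (s'.d j) (s'.γ j)
  /-- rotate the superdiagonal and the diagonal -/
  super_diag : FlApply u Q (s.β j) (s.d (j + 1)) (s'.β j) (s'.d (j + 1))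
  /-- rotate `p`, then correct `p_j` to `-β_j / q_{j+1}^*` if the computed value of
  `|p_j q_{j+1}^*|^2 + |p_{j+1} q_{j+1}^*|^2` exceeds that of `|β_j|^2 + |d_{j+1}|^2` -/
  rot_p : ∃ (p₀ v w : ℂ) (l r : ℝ), FlApply u Q (s.p j) (s.p (j + 1)) p₀ (s'.p (j + 1)) ∧
    Fl u (p₀ * conj (q (j + 1))) v ∧ Fl u (s'.p (j + 1) * conj (q (j + 1))) w ∧
    FlSumSq u v w l ∧ FlSumSq u (s'.β j) (s'.d (j + 1)) r ∧
    (r < l → ∃ z, Fl u (s'.β j / conj (q (j + 1))) z ∧ s'.p j = -z) ∧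
    (¬ r < l → s'.p j = p₀)
  /-- rotate the working copy of `q` -/
  rot_qt : FlApply u Q (s.qt j) (s.qt (j + 1)) (s'.qt j) (s'.qt (j + 1))
  /-- all other entries are unchanged -/
  keep_d : ∀ i, i ≠ j → i ≠ j + 1 → s'.d i = s.d i
  keep_β : ∀ i, i ≠ j → s'.β i = s.β i
  keep_γ : ∀ i, i ≠ j → i + 1 ≠ j → s'.γ i = s.γ i
  keep_p : ∀ i, i ≠ j → i ≠ j + 1 → s'.p i = s.p i
  keep_qt : ∀ i, i ≠ j → i ≠ j + 1 → s'.qt i = s.qt i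

/-- The elimination of the whole superdiagonal (`j = n-2, …, 1, 0`), carried out in floating point
arithmetic on the generators of `A` and on `p`, `q`. `S j` is the state right after the elimination
in position `(j, j+1)`, so that the output is `S 0`; `x j` and `Q j` are the computed `2`-vector and
the computed rotation of that pass. -/
structure ElimRun (u : ℝ) {n : ℕ} (A : Matrix (Fin n) (Fin n) ℂ) (p q : Fin n → ℂ)
    (S : ℕ → ElimState) (x : ℕ → ℂ × ℂ) (Q : ℕ → Matrix (Fin 2) (Fin 2) ℂ) : Prop where
  init : S (n - 1) = elimInit A p q
  step : ∀ j, j + 1 < n → ElimStep u (arr q) j (S (j + 1)) (S j) (x j) (Q j)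

/-! ### Rotating back to Hessenberg form, in floating point arithmetic -/

/-- The variables of the rotation back: diagonal `d`, superdiagonal `β`, and the vector `q`. -/
structure BackState where
  d : ℕ → ℂ
  β : ℕ → ℂ
  q : ℕ → ℂ

/-- One pass of the loop, carried out in floating point arithmetic: columns `j` and `j+1` (numbered
from `0`) are rotated by `Q^*` from the right. The subdiagonal `γ` and the vector `p` are inputs
that do not change. -/
structure BackStep (u : ℝ) (γ p : ℕ → ℂ) (Q : Matrix (Fin 2) (Fin 2) ℂ) (j : ℕ)
    (s s' : BackState) : Prop where
  /-- rotate the diagonal and the superdiagonal, the latter being `-p_j q_{j+1}^*` -/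
  diag_super : ∃ w, Fl u (p j * conj (s.q (j + 1))) w ∧
    FlApply u (Q.map conj) (s.d j) (-w) (s'.d j) (s'.β j)
  /-- rotate the subdiagonal and the diagonal, keeping the diagonal only -/
  sub_diag : FlDot u (conj (Q 1 0)) (conj (Q 1 1)) (γ j) (s.d (j + 1)) (s'.d (j + 1))
  /-- rotate `q` -/
  rot_q : FlApply u Q (s.q j) (s.q (j + 1)) (s'.q j) (s'.q (j + 1))
  /-- all other entries are unchanged -/
  keep_d : ∀ i, i ≠ j → i ≠ j + 1 → s'.d i = s.d i
  keep_β : ∀ i, i ≠ j → s'.β i = s.β i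
  keep_q : ∀ i, i ≠ j → i ≠ j + 1 → s'.q i = s.q i

/-- The rotation back (`j = n-2, …, 1, 0`), carried out in floating point arithmetic on the inputs
`d`, `γ`, `p`, `q` and the rotations `Q j`. `T j` is the state right after the pass `j`, so that the
output is `T 0`. The initial content of `β` is irrelevant and left free. -/
structure BackRun (u : ℝ) (n : ℕ) (d γ p q : ℕ → ℂ) (Q : ℕ → Matrix (Fin 2) (Fin 2) ℂ)
    (T : ℕ → BackState) : Prop where
  init_d : (T (n - 1)).d = d
  init_q : (T (n - 1)).q = q
  step : ∀ j, j + 1 < n → BackStep u γ p (Q j) j (T (j + 1)) (T j)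

end HermRankOneQR

namespace HermRankOneQR

/-! ### Error bounds for elementary floating point operations -/

/-! Each pass mixes two rows of the matrix encoded by the generators; in the rotation back, these
are rows of the conjugate transpose. Suppose that in every column the two affected entries are those
of the exact rotation up to O(u) times their own size. Then the Frobenius error of the pass is O(u)
relative to the whole matrix (`norm_sub_planeMatrix_mul_le`). Exact rotations do not increase the
norm, so all passes together cost O(nu) (`norm_sub_planeProduct_mul_le`), well within the claimed
n³u.

The delicate point is the eliminated entry, which is henceforth represented by -p_j conj(q_{j+1}):
an error that is small relative to p may be large relative to the column (β_j, d_{j+1}) that it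
represents. The exact rotation annihilates the computed x, so after rotation β_j and -p_j
conj(q_{j+1}) agree up to O(u) times the sum of the sizes of the two columns (β_j, d_{j+1}) and
(p_j, p_{j+1}) conj(q_{j+1}). The test in the algorithm finds out which column dominates. If it is
the second, recomputing p_j from β_j is a small change of p; if not, keeping p_j is a small change
of the represented entry. Thus p and the matrix are accurate simultaneously
(`ElimStep.norm_sub_p_le`).

The generators lose track of some entries. These are completed by exact rotations, which add no
error, and they never influence the entries that are kept. This yields B close to UA
(`ElimRun.exists_matrix`) and N close to UBᴴ (`BackRun.exists_matrix`), so Nᴴ is close to UAUᴴ. The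
computed matrix shares its upper triangle with Nᴴ, and `norm_sub_le_of_upper` extends the bound to
its lower triangle. -/

theorem Fl.norm_sub_le {𝕜 : Type} [RCLike 𝕜] {u : ℝ} {x y : 𝕜} (h : Fl u x y) :
    ‖y - x‖ ≤ u * ‖x‖ := by
  obtain ⟨δ, hδ, rfl⟩ := h
  rw [show x * (1 + δ) - x = δ * x by ring, norm_mul]
  exact mul_le_mul_of_nonneg_right hδ (norm_nonneg _)

theorem norm_add_err {E : Type*} [SeminormedAddCommGroup E] {a b : E} {r : ℝ} (h : ‖a - b‖ ≤ r) :
    ‖a‖ ≤ ‖b‖ + r := by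
  have := norm_le_insert' a b
  linarith

/-- Measuring against the exact coefficients `a'`, `b'` absorbs the error of the computed rotation
here, so that all later estimates involve exact rotations only. The radius 10u is the one supplied
by `FlRot.exists_near`. -/
theorem FlDot.norm_sub_le {u : ℝ} {a b a' b' x y z : ℂ} (hu : 0 ≤ u) (hu1 : u ≤ 1 / 1000)
    (h : FlDot u a b x y z) (ha : ‖a - a'‖ ≤ 10 * u) (hb : ‖b - b'‖ ≤ 10 * u)
    (ha' : ‖a'‖ ≤ 1) (hb' : ‖b'‖ ≤ 1) :
    ‖z - (a' * x + b' * y)‖ ≤ 16 * u * (‖x‖ + ‖y‖) := by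
  obtain ⟨s, t, hs, ht, hz⟩ := h
  have key : ∀ {a a' x s : ℂ}, Fl u (a * x) s → ‖a - a'‖ ≤ 10 * u → ‖a'‖ ≤ 1 →
      ‖s - a' * x‖ ≤ 12 * u * ‖x‖ := by
    intro a a' x s hs ha ha'
    have h1 := hs.norm_sub_le
    have h2 := norm_add_err ha
    have h3 : ‖(a - a') * x‖ ≤ 10 * u * ‖x‖ := by
      rw [norm_mul]; exact mul_le_mul_of_nonneg_right ha (norm_nonneg _)
    have h4 : u * ‖a * x‖ ≤ 2 * u * ‖x‖ := by
      rw [norm_mul]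
      have : ‖a‖ * ‖x‖ ≤ 2 * ‖x‖ := mul_le_mul_of_nonneg_right (by linarith) (norm_nonneg _)
      nlinarith
    have h5 := norm_add_le (s - a * x) ((a - a') * x)
    rw [show s - a * x + (a - a') * x = s - a' * x by ring] at h5
    linarith
  have h1 := key hs ha ha'
  have h2 := key ht hb hb'
  have h3 := hz.norm_sub_le
  have bd : ∀ {a' x s : ℂ}, ‖s - a' * x‖ ≤ 12 * u * ‖x‖ → ‖a'‖ ≤ 1 → ‖s‖ ≤ 2 * ‖x‖ := by
    intro a' x s h ha'
    have h1 := norm_add_err h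
    rw [norm_mul] at h1
    have h2 := mul_le_mul_of_nonneg_right ha' (norm_nonneg x)
    have h3 := mul_le_mul_of_nonneg_right hu1 (norm_nonneg x)
    nlinarith [norm_nonneg x]
  have h4 : ‖s + t‖ ≤ 2 * (‖x‖ + ‖y‖) := by
    linarith [norm_add_le s t, bd h1 ha', bd h2 hb']
  have h5 : u * ‖s + t‖ ≤ u * (2 * (‖x‖ + ‖y‖)) := mul_le_mul_of_nonneg_left h4 hu
  have h6 : ‖z - (a' * x + b' * y)‖ ≤ ‖z - (s + t)‖ + ‖s - a' * x‖ + ‖t - b' * y‖ := by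
    rw [show z - (a' * x + b' * y) = z - (s + t) + (s - a' * x) + (t - b' * y) by ring]
    exact norm_add₃_le
  nlinarith [norm_nonneg x, norm_nonneg y, mul_nonneg hu (norm_nonneg x),
    mul_nonneg hu (norm_nonneg y)]

/-- Covers an operand taken from the rank-one part, which is itself a rounded product; that extra
rounding is charged here. -/
theorem FlDot.norm_sub_le_of_neg_mul {u : ℝ} {a b a' b' x y w z : ℂ} (hu : 0 ≤ u)
    (hu1 : u ≤ 1 / 1000)
    (h : FlDot u a b x (-w) z) (hw : Fl u y w) (ha : ‖a - a'‖ ≤ 10 * u) (hb : ‖b - b'‖ ≤ 10 * u)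
    (ha' : ‖a'‖ ≤ 1) (hb' : ‖b'‖ ≤ 1) :
    ‖z - (a' * x + b' * -y)‖ ≤ 20 * u * (‖x‖ + ‖-y‖) := by
  have h1 := h.norm_sub_le hu hu1 ha hb ha' hb'
  have h2 := hw.norm_sub_le
  have h3 : ‖w‖ ≤ 2 * ‖y‖ := by nlinarith [norm_add_err h2, norm_nonneg y]
  have h4 : ‖b' * (y - w)‖ ≤ u * ‖y‖ := by
    rw [norm_mul, norm_sub_rev]
    nlinarith [norm_nonneg (w - y)]
  have h5 := norm_add_le (z - (a' * x + b' * -w)) (b' * (y - w))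
  rw [show z - (a' * x + b' * -w) + b' * (y - w) = z - (a' * x + b' * -y) by ring] at h5
  rw [norm_neg] at *
  have h6 : u * ‖w‖ ≤ u * (‖y‖ + u * ‖y‖) := mul_le_mul_of_nonneg_left (norm_add_err h2) hu
  nlinarith [mul_nonneg hu (norm_nonneg x), mul_nonneg hu (norm_nonneg y)]

theorem FlNormSq.abs_sub_le {u : ℝ} {z : ℂ} {t : ℝ} (hu : 0 ≤ u) (hu1 : u ≤ 1 / 1000)
    (h : FlNormSq u z t) : |t - ‖z‖ ^ 2| ≤ 5 / 2 * u * ‖z‖ ^ 2 := by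
  obtain ⟨a, b, ha, hb, ht⟩ := h
  have h1 := ha.norm_sub_le
  have h2 := hb.norm_sub_le
  have h3 := ht.norm_sub_le
  have hz : ‖z‖ ^ 2 = z.re * z.re + z.im * z.im := by
    rw [← Complex.normSq_eq_norm_sq, Complex.normSq_apply]
  rw [hz]
  have p1 := mul_self_nonneg z.re
  have p2 := mul_self_nonneg z.im
  rw [Real.norm_eq_abs, Real.norm_eq_abs] at h1 h2 h3
  rw [abs_of_nonneg p1] at h1
  rw [abs_of_nonneg p2] at h2
  generalize z.re * z.re = X at *
  generalize z.im * z.im = Y at *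
  have h4 : |a + b - (X + Y)| ≤ u * (X + Y) := by
    rw [show a + b - (X + Y) = (a - X) + (b - Y) by ring]
    linarith [abs_add_le (a - X) (b - Y)]
  have h5 : |a + b| ≤ (1 + u) * (X + Y) := by
    have := abs_add_le (a + b - (X + Y)) (X + Y)
    rw [sub_add_cancel, abs_of_nonneg (add_nonneg p1 p2)] at this
    linarith
  have h6 := abs_add_le (t - (a + b)) (a + b - (X + Y))
  rw [sub_add_sub_cancel] at h6
  have h7 : u * |a + b| ≤ u * ((1 + u) * (X + Y)) := mul_le_mul_of_nonneg_left h5 hu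
  have h8 : u * (u * (X + Y)) ≤ u * (1 / 1000 * (X + Y)) := by gcongr
  have := mul_nonneg hu (add_nonneg p1 p2)
  nlinarith

theorem FlSumSq.abs_sub_le {u : ℝ} {z w : ℂ} {t : ℝ} (hu : 0 ≤ u) (hu1 : u ≤ 1 / 1000)
    (h : FlSumSq u z w t) : |t - (‖z‖ ^ 2 + ‖w‖ ^ 2)| ≤ 4 * u * (‖z‖ ^ 2 + ‖w‖ ^ 2) := by
  obtain ⟨a, b, ha, hb, ht⟩ := h
  have h1 := ha.abs_sub_le hu hu1
  have h2 := hb.abs_sub_le hu hu1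
  have h3 := ht.norm_sub_le
  have p1 := sq_nonneg ‖z‖
  have p2 := sq_nonneg ‖w‖
  rw [Real.norm_eq_abs, Real.norm_eq_abs] at h3
  generalize ‖z‖ ^ 2 = X at *
  generalize ‖w‖ ^ 2 = Y at *
  have h4 : |a + b - (X + Y)| ≤ 5 / 2 * u * (X + Y) := by
    rw [show a + b - (X + Y) = (a - X) + (b - Y) by ring]
    linarith [abs_add_le (a - X) (b - Y)]
  have h5 : |a + b| ≤ (1 + 5 / 2 * u) * (X + Y) := by
    have := abs_add_le (a + b - (X + Y)) (X + Y)
    rw [sub_add_cancel, abs_of_nonneg (add_nonneg p1 p2)] at this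
    linarith
  have h6 := abs_add_le (t - (a + b)) (a + b - (X + Y))
  rw [sub_add_sub_cancel] at h6
  have h7 : u * |a + b| ≤ u * ((1 + 5 / 2 * u) * (X + Y)) := mul_le_mul_of_nonneg_left h5 hu
  have h8 : u * (u * (X + Y)) ≤ u * (1 / 1000 * (X + Y)) := by gcongr
  have := mul_nonneg hu (add_nonneg p1 p2)
  nlinarith

/-- If the computed value of `|z|^2 + |w|^2` does not exceed that of `|z'|^2 + |w'|^2`, then
`|z| + |w|` is at most twice `|z'| + |w'|`. -/
theorem FlSumSq.norm_add_norm_le {u : ℝ} {z w z' w' : ℂ} {t t' : ℝ} (hu : 0 ≤ u)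
    (hu1 : u ≤ 1 / 1000) (h : FlSumSq u z w t) (h' : FlSumSq u z' w' t') (htt : t ≤ t') :
    ‖z‖ + ‖w‖ ≤ 2 * (‖z'‖ + ‖w'‖) := by
  have h1 := (abs_le.1 (h.abs_sub_le hu hu1)).1
  have h2 := (abs_le.1 (h'.abs_sub_le hu hu1)).2
  have a1 := norm_nonneg z
  have a2 := norm_nonneg w
  have a3 := norm_nonneg z'
  have a4 := norm_nonneg w'
  generalize ‖z‖ = a at *
  generalize ‖w‖ = b at *
  generalize ‖z'‖ = c at *
  generalize ‖w'‖ = d at *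
  have h3 : u * (a ^ 2 + b ^ 2) ≤ 1 / 1000 * (a ^ 2 + b ^ 2) := by gcongr
  have h4 : u * (c ^ 2 + d ^ 2) ≤ 1 / 1000 * (c ^ 2 + d ^ 2) := by gcongr
  have h5 : a ^ 2 + b ^ 2 ≤ 2 * (c ^ 2 + d ^ 2) := by nlinarith
  -- (a + b)² ≤ 2(a² + b²) ≤ 4(c² + d²) ≤ 4(c + d)².
  refine abs_le_of_sq_le_sq' ?_ (by positivity) |>.2
  nlinarith [sq_nonneg (a - b), mul_nonneg a3 a4]

/-! ### Exact and computed rotations -/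

theorem exactRot_eq (x : ℂ × ℂ) : ∃ c s : ℂ, exactRot x = rotMatrix c s ∧
    ‖c‖ ^ 2 + ‖s‖ ^ 2 = 1 ∧ c * x.1 = s * x.2 ∧
    (x ≠ 0 → c = x.2 / (Real.sqrt (‖x.1‖ ^ 2 + ‖x.2‖ ^ 2) : ℂ) ∧
      s = x.1 / (Real.sqrt (‖x.1‖ ^ 2 + ‖x.2‖ ^ 2) : ℂ)) := by
  by_cases hx : x = 0
  · refine ⟨1, 0, by simp [exactRot, hx], by simp, by simp [hx], fun h => absurd hx h⟩
  · refine ⟨_, _, by rw [exactRot, if_neg hx], ?_, ?_, fun _ => ⟨rfl, rfl⟩⟩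
    · have hpos : 0 < ‖x.1‖ ^ 2 + ‖x.2‖ ^ 2 := by
        rcases not_and_or.1 (fun h => hx (Prod.ext_iff.2 h)) with h | h
        · have := norm_pos_iff.2 h; positivity
        · have := norm_pos_iff.2 h; positivity
      rw [norm_div, norm_div, div_pow, div_pow, Complex.norm_real, Real.norm_eq_abs, sq_abs,
        Real.sq_sqrt hpos.le]
      field_simp
      ring
    · ring

/-- A quotient computed with a perturbed denominator. -/
theorem Fl.norm_sub_div_le {u ρ r : ℝ} {a b : ℂ} (hu : 0 ≤ u) (hρpos : 0 < ρ) (hrpos : 0 < r)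
    (hr : |ρ - r| ≤ 6 * u * ρ) (hr' : 8 / 9 * ρ ≤ r) (ha : ‖a‖ ≤ ρ)
    (hb : Fl u (a / (r : ℂ)) b) : ‖b - a / (ρ : ℂ)‖ ≤ 10 * u := by
  have e1 := hb.norm_sub_le
  have e2 : ‖a / (r : ℂ)‖ ≤ 9 / 8 := by
    rw [norm_div, Complex.norm_real, Real.norm_eq_abs, abs_of_pos hrpos, div_le_iff₀ hrpos]
    linarith
  have e3 : ‖a / (r : ℂ) - a / (ρ : ℂ)‖ ≤ 1 * (27 / 4 * u) := by
    have : a / (r : ℂ) - a / (ρ : ℂ) = (a / (ρ : ℂ)) * (((ρ - r : ℝ) : ℂ) / (r : ℂ)) := by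
      have := Complex.ofReal_ne_zero.2 hrpos.ne'
      have := Complex.ofReal_ne_zero.2 hρpos.ne'
      push_cast
      field_simp
    rw [this, norm_mul]
    have f1 : ‖a / (ρ : ℂ)‖ ≤ 1 := by
      rw [norm_div, Complex.norm_real, Real.norm_eq_abs, abs_of_pos hρpos, div_le_iff₀ hρpos]
      linarith
    have f2 : ‖((ρ - r : ℝ) : ℂ) / (r : ℂ)‖ ≤ 27 / 4 * u := by
      rw [norm_div, Complex.norm_real, Complex.norm_real, Real.norm_eq_abs,
        Real.norm_eq_abs, abs_of_pos hrpos, div_le_iff₀ hrpos]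
      have := mul_le_mul_of_nonneg_left hr' hu
      linarith
    exact mul_le_mul f1 f2 (norm_nonneg _) zero_le_one
  have e4 := norm_add_le (b - a / (r : ℂ)) (a / (r : ℂ) - a / (ρ : ℂ))
  rw [sub_add_sub_cancel] at e4
  have e5 := mul_le_mul_of_nonneg_left e2 hu
  linarith

/-- A computed rotation is entrywise close to the exact one. -/
theorem FlRot.exists_near {u : ℝ} {x : ℂ × ℂ} {Q : Matrix (Fin 2) (Fin 2) ℂ} (hu : 0 ≤ u)
    (hu1 : u ≤ 1 / 1000) (h : FlRot u x Q) : ∃ c s c' s' : ℂ, exactRot x = rotMatrix c s ∧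
    Q = rotMatrix c' s' ∧ ‖c' - c‖ ≤ 10 * u ∧ ‖s' - s‖ ≤ 10 * u ∧ ‖c‖ ^ 2 + ‖s‖ ^ 2 = 1 ∧
    c * x.1 = s * x.2 := by
  obtain ⟨c, s, hR, hcs, hker, hform⟩ := exactRot_eq x
  by_cases hx : x = 0
  · refine ⟨c, s, c, s, hR, ?_, by simpa, by simpa, hcs, hker⟩
    rw [h.1 hx, ← hR]; simp [exactRot, hx]
  · obtain ⟨t, r, c', s', ht, hr, hc, hs, hQ⟩ := h.2 hx
    obtain ⟨hc0, hs0⟩ := hform hx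
    refine ⟨c, s, c', s', hR, hQ, ?_, ?_, hcs, hker⟩
    all_goals
      have hpos : 0 < ‖x.1‖ ^ 2 + ‖x.2‖ ^ 2 := by
        rcases not_and_or.1 (fun h => hx (Prod.ext_iff.2 h)) with h | h
        · have := norm_pos_iff.2 h; positivity
        · have := norm_pos_iff.2 h; positivity
      have h1 := abs_le.1 (ht.abs_sub_le hu hu1)
      have h2 := hr.norm_sub_le
      set X := ‖x.1‖ ^ 2 + ‖x.2‖ ^ 2 with hX
      set ρ := Real.sqrt X with hρ
      have hρpos : 0 < ρ := Real.sqrt_pos.2 hpos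
      have hρ2 : ρ ^ 2 = X := Real.sq_sqrt hpos.le
      -- A relative error 4u in the sum of squares is at most 4u in its root. Rounding the root adds
      -- at most 2uρ, which gives the 6u in `rlo`.
      have lo : (1 - 4 * u) * ρ ≤ Real.sqrt t := by
        apply Real.le_sqrt_of_sq_le
        rw [mul_pow, hρ2]
        nlinarith
      have hi : Real.sqrt t ≤ (1 + 4 * u) * ρ := by
        apply Real.sqrt_le_iff.2 ⟨by positivity, ?_⟩
        rw [mul_pow, hρ2]
        nlinarith [mul_nonneg hu hpos.le]
      rw [Real.norm_eq_abs, Real.norm_eq_abs, abs_of_nonneg (Real.sqrt_nonneg t)] at h2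
      have h2' := abs_le.1 h2
      have huρ : u * Real.sqrt t ≤ 2 * (u * ρ) := by
        have := mul_le_mul_of_nonneg_left hi hu
        nlinarith [mul_nonneg hu hρpos.le]
      have rlo : |ρ - r| ≤ 6 * u * ρ := by rw [abs_le]; constructor <;> linarith
      have rhalf : 8 / 9 * ρ ≤ r := by
        have := (abs_le.1 rlo).2
        nlinarith
      have hrpos : 0 < r := by linarith
    · rw [hc0]
      exact Fl.norm_sub_div_le hu hρpos hrpos rlo rhalf
        (Real.le_sqrt_of_sq_le (by rw [hX]; nlinarith [sq_nonneg ‖x.1‖])) hc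
    · rw [hs0]
      exact Fl.norm_sub_div_le hu hρpos hrpos rlo rhalf
        (Real.le_sqrt_of_sq_le (by rw [hX]; nlinarith [sq_nonneg ‖x.2‖])) hs

/-- The computed rotation `Q` is entrywise close to the rotation `R`. -/
structure RotNear (u : ℝ) (Q R : Matrix (Fin 2) (Fin 2) ℂ) : Prop where
  near : ∀ i j, ‖Q i j - R i j‖ ≤ 10 * u
  le_one : ∀ i j, ‖R i j‖ ≤ 1

theorem FlRot.rotNear {u : ℝ} {x : ℂ × ℂ} {Q : Matrix (Fin 2) (Fin 2) ℂ} (hu : 0 ≤ u)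
    (hu1 : u ≤ 1 / 1000) (h : FlRot u x Q) : RotNear u Q (exactRot x) := by
  obtain ⟨c, s, c', s', hR, hQ, hc, hs, hcs, -⟩ := h.exists_near hu hu1
  rw [hR, hQ]
  have c1 : ‖c‖ ≤ 1 := by nlinarith [sq_nonneg ‖s‖, norm_nonneg c]
  have s1 : ‖s‖ ≤ 1 := by nlinarith [sq_nonneg ‖c‖, norm_nonneg s]
  constructor
  · intro i j
    fin_cases i <;> fin_cases j <;> simp [rotMatrix, ← map_sub, hc, hs]
    rwa [neg_add_eq_sub, norm_sub_rev]
  · intro i j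
    fin_cases i <;> fin_cases j <;> simp [rotMatrix, c1, s1]

theorem FlApply.norm_sub_le {u : ℝ} {Q R : Matrix (Fin 2) (Fin 2) ℂ} {x y x' y' : ℂ} (hu : 0 ≤ u)
    (hu1 : u ≤ 1 / 1000) (hQ : RotNear u Q R) (h : FlApply u Q x y x' y') :
    ‖x' - (R 0 0 * x + R 0 1 * y)‖ ≤ 16 * u * (‖x‖ + ‖y‖) ∧
      ‖y' - (R 1 0 * x + R 1 1 * y)‖ ≤ 16 * u * (‖x‖ + ‖y‖) :=
  ⟨h.1.norm_sub_le hu hu1 (hQ.near 0 0) (hQ.near 0 1) (hQ.le_one 0 0) (hQ.le_one 0 1),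
    h.2.norm_sub_le hu hu1 (hQ.near 1 0) (hQ.near 1 1) (hQ.le_one 1 0) (hQ.le_one 1 1)⟩

theorem exactRot_normSq (x : ℂ × ℂ) (a b : ℂ) :
    ‖exactRot x 0 0 * a + exactRot x 0 1 * b‖ ^ 2 + ‖exactRot x 1 0 * a + exactRot x 1 1 * b‖ ^ 2
      = ‖a‖ ^ 2 + ‖b‖ ^ 2 := by
  obtain ⟨c, s, hR, hcs, -, -⟩ := exactRot_eq x
  have : ∀ z : ℂ, ((‖z‖ : ℝ) : ℂ) ^ 2 = z * conj z := fun z => by rw [Complex.mul_conj']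
  rw [hR]
  have hcs' : c * conj c + s * conj s = 1 := by rw [← this, ← this]; exact_mod_cast hcs
  apply Complex.ofReal_injective
  push_cast
  simp only [this, rotMatrix, Matrix.of_apply, Matrix.cons_val', Matrix.cons_val_zero,
    Matrix.cons_val_one, Matrix.cons_val_fin_one, map_add, map_mul, map_neg, Complex.conj_conj]
  linear_combination (a * conj a + b * conj b) * hcs'

theorem exactRot_fst (x : ℂ × ℂ) : exactRot x 0 0 * x.1 + exactRot x 0 1 * x.2 = 0 := by
  obtain ⟨c, s, hR, -, h, -⟩ := exactRot_eq x
  rw [hR]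
  simp [rotMatrix, h]

/-- A vector close to a rotated one has comparable norm. -/
theorem norm_le_of_rotated {u : ℝ} {x : ℂ × ℂ} {a b a' b' : ℂ} (hu1 : u ≤ 1 / 1000)
    (ha : ‖a' - (exactRot x 0 0 * a + exactRot x 0 1 * b)‖ ≤ 16 * u * (‖a‖ + ‖b‖))
    (hb : ‖b' - (exactRot x 1 0 * a + exactRot x 1 1 * b)‖ ≤ 16 * u * (‖a‖ + ‖b‖)) :
    ‖a‖ + ‖b‖ ≤ 4 * (‖a'‖ + ‖b'‖) ∧ ‖a'‖ + ‖b'‖ ≤ 4 * (‖a‖ + ‖b‖) := by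
  have h := exactRot_normSq x a b
  generalize exactRot x 0 0 * a + exactRot x 0 1 * b = A at *
  generalize exactRot x 1 0 * a + exactRot x 1 1 * b = B at *
  have h1 : ‖a‖ + ‖b‖ ≤ 2 * (‖A‖ + ‖B‖) := by
    refine abs_le_of_sq_le_sq' ?_ (by positivity) |>.2
    nlinarith [sq_nonneg (‖a‖ - ‖b‖), mul_nonneg (norm_nonneg A) (norm_nonneg B)]
  have h2 : ‖A‖ + ‖B‖ ≤ 2 * (‖a‖ + ‖b‖) := by
    refine abs_le_of_sq_le_sq' ?_ (by positivity) |>.2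
    nlinarith [sq_nonneg (‖A‖ - ‖B‖), mul_nonneg (norm_nonneg a) (norm_nonneg b)]
  have h3 := norm_add_err ha
  have h4 := norm_add_err hb
  rw [norm_sub_rev] at ha hb
  have h5 := norm_add_err ha
  have h6 := norm_add_err hb
  have h7 : u * (‖a‖ + ‖b‖) ≤ 1 / 1000 * (‖a‖ + ‖b‖) := by gcongr
  have := norm_nonneg a
  have := norm_nonneg b
  constructor <;> nlinarith

/-! ### Plane matrices and Frobenius norms -/

theorem planeMatrix_mul_apply {ι : Type*} [Fintype ι] {n j : ℕ} (hj : j + 1 < n)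
    (R : Matrix (Fin 2) (Fin 2) ℂ) (M : Matrix (Fin n) ι ℂ) (a : Fin n) (b : ι) :
    (planeMatrix n j R * M) a b =
      if (a : ℕ) = j then R 0 0 * M ⟨j, by omega⟩ b + R 0 1 * M ⟨j + 1, hj⟩ b
      else if (a : ℕ) = j + 1 then R 1 0 * M ⟨j, by omega⟩ b + R 1 1 * M ⟨j + 1, hj⟩ b
      else M a b := by
  rw [Matrix.mul_apply]
  have two : ∀ y z : ℂ, y * M ⟨j, by omega⟩ b + z * M ⟨j + 1, hj⟩ b = ∑ c : Fin n,
      ((if c = ⟨j, by omega⟩ then y * M c b else 0) +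
        (if c = ⟨j + 1, hj⟩ then z * M c b else 0)) := by
    intro y z
    rw [Finset.sum_add_distrib, Finset.sum_ite_eq', Finset.sum_ite_eq']
    simp
  split_ifs with h1 h2
  · rw [two]
    refine Finset.sum_congr rfl fun c _ => ?_
    simp only [planeMatrix, Matrix.of_apply, Fin.ext_iff]
    split_ifs <;> first | omega | simp
  · rw [two]
    refine Finset.sum_congr rfl fun c _ => ?_
    simp only [planeMatrix, Matrix.of_apply, Fin.ext_iff]
    split_ifs <;> first | omega | simp
  · rw [Finset.sum_eq_single a]
    · simp [planeMatrix, h1, h2]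
    · intro c _ hc
      have : (a : ℕ) ≠ c := fun h => hc (Fin.ext h.symm)
      simp [planeMatrix, h1, h2, hc.symm]
    · simp

theorem frobenius_norm_sq {m ι : Type*} [Fintype m] [Fintype ι] (M : Matrix m ι ℂ) :
    ‖M‖ ^ 2 = ∑ a, ∑ b, ‖M a b‖ ^ 2 := by
  rw [Matrix.frobenius_norm_def, ← Real.rpow_natCast, ← Real.rpow_mul (by positivity)]
  norm_num

/-- Comparison of Frobenius norms by rows, two of them being compared columnwise. -/
theorem frobenius_norm_le_of_rows {ι : Type*} [Fintype ι] {n j : ℕ} (hj : j + 1 < n) {k : ℝ}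
    (hk : 0 ≤ k) (E M : Matrix (Fin n) ι ℂ)
    (h : ∀ (a : Fin n) (b : ι), (a : ℕ) ≠ j → (a : ℕ) ≠ j + 1 → ‖E a b‖ ≤ k * ‖M a b‖)
    (h2 : ∀ b : ι, ‖E ⟨j, by omega⟩ b‖ ^ 2 + ‖E ⟨j + 1, hj⟩ b‖ ^ 2 ≤
      k ^ 2 * (‖M ⟨j, by omega⟩ b‖ ^ 2 + ‖M ⟨j + 1, hj⟩ b‖ ^ 2)) :
    ‖E‖ ≤ k * ‖M‖ := by
  refine abs_le_of_sq_le_sq' ?_ (by positivity) |>.2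
  rw [mul_pow, frobenius_norm_sq, frobenius_norm_sq, Finset.sum_comm,
    Finset.sum_comm (f := fun a b => ‖M a b‖ ^ 2), Finset.mul_sum]
  refine Finset.sum_le_sum fun b _ => ?_
  have hmem : (⟨j + 1, hj⟩ : Fin n) ∈ Finset.univ.erase (⟨j, by omega⟩ : Fin n) := by
    simp [Fin.ext_iff]
  have split : ∀ f : Fin n → ℝ, ∑ a, f a = f ⟨j, by omega⟩ + f ⟨j + 1, hj⟩ +
      ∑ a ∈ (Finset.univ.erase (⟨j, by omega⟩ : Fin n)).erase ⟨j + 1, hj⟩, f a := by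
    intro f
    rw [add_assoc, Finset.add_sum_erase _ _ hmem, Finset.add_sum_erase _ _ (Finset.mem_univ _)]
  rw [split, split, mul_add, Finset.mul_sum]
  refine add_le_add (h2 b) (Finset.sum_le_sum fun a ha => ?_)
  simp only [Finset.mem_erase, Finset.mem_univ, and_true, ne_eq, Fin.ext_iff] at ha
  rw [← mul_pow]
  exact pow_le_pow_left₀ (norm_nonneg _) (h a b ha.2 ha.1) 2

theorem planeMatrix_mul_norm_le {ι : Type*} [Fintype ι] {n j : ℕ} (hj : j + 1 < n) (x : ℂ × ℂ)
    (M : Matrix (Fin n) ι ℂ) : ‖planeMatrix n j (exactRot x) * M‖ ≤ ‖M‖ := by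
  rw [← one_mul ‖M‖]
  refine frobenius_norm_le_of_rows hj zero_le_one _ _ (fun a b h1 h2 => ?_) fun b => ?_
  · rw [planeMatrix_mul_apply hj, if_neg h1, if_neg h2, one_mul]
  · rw [planeMatrix_mul_apply hj, planeMatrix_mul_apply hj]
    simp [exactRot_normSq]

/-- The matrix with `n` rows whose entries are given by a function of the row index. -/
def rowMatrix (n : ℕ) {ι : Type*} (f : ℕ → ι → ℂ) : Matrix (Fin n) ι ℂ :=
  Matrix.of fun a b => f a b

/-- Two errors of size ε(|a| + |b|) have square sum 2ε²(|a| + |b|)² ≤ (2ε)²(|a|² + |b|²), whence the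
factor 2. The column index type is arbitrary, so that the bound serves matrices as well as vectors,
seen as matrices with a single column. -/
theorem norm_sub_planeMatrix_mul_le {ι : Type*} [Fintype ι] {n j : ℕ} (hj : j + 1 < n) {ε : ℝ}
    (hε : 0 ≤ ε) (R : Matrix (Fin 2) (Fin 2) ℂ) (f' f : ℕ → ι → ℂ)
    (h : ∀ a b, a < n → a ≠ j → a ≠ j + 1 → f' a b = f a b)
    (h0 : ∀ b, ‖f' j b - (R 0 0 * f j b + R 0 1 * f (j + 1) b)‖ ≤
      ε * (‖f j b‖ + ‖f (j + 1) b‖))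
    (h1 : ∀ b, ‖f' (j + 1) b - (R 1 0 * f j b + R 1 1 * f (j + 1) b)‖ ≤
      ε * (‖f j b‖ + ‖f (j + 1) b‖)) :
    ‖rowMatrix n f' - planeMatrix n j R * rowMatrix n f‖ ≤ 2 * ε * ‖rowMatrix n f‖ := by
  refine frobenius_norm_le_of_rows hj (by positivity) _ _ (fun a b ha1 ha2 => ?_) fun b => ?_
  · rw [Matrix.sub_apply, planeMatrix_mul_apply hj, if_neg ha1, if_neg ha2]
    simp only [rowMatrix, Matrix.of_apply]
    rw [h a b a.2 ha1 ha2, sub_self, norm_zero]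
    positivity
  · rw [Matrix.sub_apply, planeMatrix_mul_apply hj, Matrix.sub_apply, planeMatrix_mul_apply hj]
    simp only [rowMatrix, Matrix.of_apply, if_true, if_neg (Nat.succ_ne_self j)]
    have e0 := pow_le_pow_left₀ (norm_nonneg _) (h0 b) 2
    have e1 := pow_le_pow_left₀ (norm_nonneg _) (h1 b) 2
    nlinarith [mul_nonneg (sq_nonneg ε) (sq_nonneg (‖f j b‖ - ‖f (j + 1) b‖))]

/-! ### Accumulation of errors over a sequence of plane rotations -/

theorem list_prod_planeMatrix_mul_norm_le {ι : Type*} [Fintype ι] {n : ℕ} (x : ℕ → ℂ × ℂ) (m : ℕ)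
    (hm : m ≤ n - 1) (X : Matrix (Fin n) ι ℂ) :
    ‖((List.range m).map fun j => planeMatrix n j (exactRot (x j))).prod * X‖ ≤ ‖X‖ := by
  induction m generalizing X with
  | zero => simp
  | succ m ih =>
    rw [List.range_succ, List.map_append, List.prod_append, List.map_singleton,
      List.prod_singleton, Matrix.mul_assoc]
    exact (ih (by omega) _).trans (planeMatrix_mul_norm_le (by omega) _ _)

theorem planeProduct_mul_norm_le {ι : Type*} [Fintype ι] {n : ℕ} (x : ℕ → ℂ × ℂ)
    (X : Matrix (Fin n) ι ℂ) : ‖planeProduct n (fun j => exactRot (x j)) * X‖ ≤ ‖X‖ :=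
  list_prod_planeMatrix_mul_norm_le x (n - 1) le_rfl X

/-- Accumulation of the errors of a sequence of plane rotations. -/
theorem norm_sub_list_prod_mul_le {ι : Type*} [Fintype ι] {n : ℕ} {ε : ℝ} (hε : 0 ≤ ε)
    (x : ℕ → ℂ × ℂ) (M : ℕ → Matrix (Fin n) ι ℂ)
    (h : ∀ j, j + 1 < n → ‖M j - planeMatrix n j (exactRot (x j)) * M (j + 1)‖ ≤ ε * ‖M (j + 1)‖)
    (m : ℕ) (hm : m ≤ n - 1) :
    ‖M 0 - ((List.range m).map fun j => planeMatrix n j (exactRot (x j))).prod * M m‖ ≤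
      ((1 + ε) ^ m - 1) * ‖M m‖ := by
  induction m with
  | zero => simp
  | succ m ih =>
    have e0 := ih (by omega)
    have hm' : m + 1 < n := by omega
    have e2 := (list_prod_planeMatrix_mul_norm_le x m (by omega) _).trans (h m hm')
    have e3 : ‖M m‖ ≤ (1 + ε) * ‖M (m + 1)‖ := by
      have := norm_add_err (h m hm')
      have := planeMatrix_mul_norm_le hm' (x m) (M (m + 1))
      linarith
    rw [List.range_succ, List.map_append, List.prod_append, List.map_singleton,
      List.prod_singleton]
    generalize ((List.range m).map fun j => planeMatrix n j (exactRot (x j))).prod = P at *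
    generalize planeMatrix n m (exactRot (x m)) = R at *
    -- Telescoping: the error of the newest factor is transported by the earlier ones, whose product
    -- does not increase norms.
    have e1 : ‖M 0 - P * R * M (m + 1)‖ ≤ ‖M 0 - P * M m‖ + ‖P * (M m - R * M (m + 1))‖ := by
      have : M 0 - P * R * M (m + 1) = (M 0 - P * M m) + P * (M m - R * M (m + 1)) := by
        rw [Matrix.mul_sub, Matrix.mul_assoc]; abel
      rw [this]; exact norm_add_le _ _
    have e4 : 0 ≤ (1 + ε) ^ m - 1 := sub_nonneg.2 (one_le_pow₀ (by linarith))
    have e5 := mul_le_mul_of_nonneg_left e3 e4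
    rw [pow_succ]
    linarith

/-- Follows from 1 + ε ≤ exp ε and |exp t - 1| ≤ 2|t| for |t| ≤ 1. -/
theorem one_add_pow_sub_one_le {ε : ℝ} (hε : 0 ≤ ε) (n : ℕ) (h : n * ε ≤ 1) :
    (1 + ε) ^ n - 1 ≤ 2 * n * ε := by
  have h1 : (1 + ε) ^ n ≤ Real.exp (n * ε) := by
    rw [Real.exp_nat_mul]
    exact pow_le_pow_left₀ (by linarith) (by linarith [Real.add_one_le_exp ε]) n
  have h0 : 0 ≤ n * ε := by positivity
  have h2 := (abs_le.1 (Real.abs_exp_sub_one_le (x := n * ε) (by rwa [abs_of_nonneg h0]))).2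
  rw [abs_of_nonneg h0] at h2
  linarith

theorem norm_sub_planeProduct_mul_le {ι : Type*} [Fintype ι] {n : ℕ} {ε : ℝ} (hε : 0 ≤ ε)
    (hn : n * ε ≤ 1) (x : ℕ → ℂ × ℂ) (M : ℕ → Matrix (Fin n) ι ℂ)
    (h : ∀ j, j + 1 < n →
      ‖M j - planeMatrix n j (exactRot (x j)) * M (j + 1)‖ ≤ ε * ‖M (j + 1)‖) :
    ‖M 0 - planeProduct n (fun j => exactRot (x j)) * M (n - 1)‖ ≤ 2 * n * ε * ‖M (n - 1)‖ := by
  refine (norm_sub_list_prod_mul_le hε x M h (n - 1) le_rfl).trans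
    (mul_le_mul_of_nonneg_right ?_ (norm_nonneg _))
  refine le_trans ?_ (one_add_pow_sub_one_le hε n hn)
  exact sub_le_sub_right (pow_le_pow_right₀ (by linarith) (Nat.sub_le n 1)) 1

/-- A matrix that is Hermitian off the diagonal approximates a Hermitian matrix as well as its upper
triangle does. -/
theorem norm_sub_le_of_upper {n : ℕ} {X Y H : Matrix (Fin n) (Fin n) ℂ} (hH : H.IsHermitian)
    (hX : ∀ a b, a < b → X b a = conj (X a b)) (hXY : ∀ a b, a ≤ b → X a b = Y a b) :
    ‖X - H‖ ≤ 2 * ‖Y - H‖ := by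
  refine abs_le_of_sq_le_sq' ?_ (by positivity) |>.2
  -- An entry of X - H has the modulus of one of two mirrored entries of Y - H. Bounding by both
  -- makes the double sum symmetric and costs only a factor 2 in the squares.
  have key : ∀ a b, ‖(X - H) a b‖ ^ 2 ≤ ‖(Y - H) a b‖ ^ 2 + ‖(Y - H) b a‖ ^ 2 := by
    intro a b
    rcases le_or_gt a b with hab | hab
    · rw [Matrix.sub_apply, hXY a b hab, ← Matrix.sub_apply]
      nlinarith [sq_nonneg ‖(Y - H) b a‖]
    · have : ‖(X - H) a b‖ = ‖(Y - H) b a‖ := by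
        rw [Matrix.sub_apply, hX b a hab, ← hH.apply a b, ← Complex.star_def, ← star_sub,
          norm_star, hXY b a hab.le, ← Matrix.sub_apply]
      rw [this]
      nlinarith [sq_nonneg ‖(Y - H) a b‖]
  have h1 : ‖X - H‖ ^ 2 ≤ 2 * ‖Y - H‖ ^ 2 := by
    rw [frobenius_norm_sq (X - H)]
    refine (Finset.sum_le_sum fun a _ => Finset.sum_le_sum fun b _ => key a b).trans ?_
    simp only [Finset.sum_add_distrib]
    rw [Finset.sum_comm (f := fun a b => ‖(Y - H) b a‖ ^ 2), ← frobenius_norm_sq, two_mul]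
  nlinarith [sq_nonneg ‖Y - H‖]

/-! ### One pass of the elimination -/

theorem Fl.norm_le_two_mul {u : ℝ} {x y : ℂ} (hu1 : u ≤ 1 / 1000) (h : Fl u x y) :
    ‖y‖ ≤ 2 * ‖x‖ ∧ ‖x‖ ≤ 2 * ‖y‖ := by
  have h1 := h.norm_sub_le
  have h2 := norm_add_err h1
  rw [norm_sub_rev] at h1
  have h3 := norm_add_err h1
  have h4 : u * ‖x‖ ≤ 1 / 1000 * ‖x‖ := by gcongr
  constructor <;> linarith [norm_nonneg x, norm_nonneg y]

/-- The error of a computed value of `β + p * q`. -/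
theorem norm_sub_add_mul_le {u : ℝ} {β pq t x : ℂ} (hu : 0 ≤ u) (hu1 : u ≤ 1 / 1000)
    (ht : Fl u pq t) (hx : Fl u (β + t) x) : ‖x - (β + pq)‖ ≤ 3 * u * (‖β‖ + ‖pq‖) := by
  have h1 := hx.norm_sub_le
  have h2 := ht.norm_sub_le
  have h3 := mul_le_mul_of_nonneg_left (norm_add_le β t) hu
  have h4 := mul_le_mul_of_nonneg_left (ht.norm_le_two_mul hu1).1 hu
  have h5 := norm_add_le (x - (β + t)) (t - pq)
  rw [show x - (β + t) + (t - pq) = x - (β + pq) by ring] at h5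
  nlinarith [mul_nonneg hu (norm_nonneg β), mul_nonneg hu (norm_nonneg pq)]

/-- The error of the rotation of `p`, including the correction, and the error of the representation
of the eliminated superdiagonal entry by `p` and `q`. -/
theorem ElimStep.norm_sub_p_le {u : ℝ} {q : ℕ → ℂ} {j : ℕ} {s s' : ElimState} {x : ℂ × ℂ}
    {Q : Matrix (Fin 2) (Fin 2) ℂ} (hu : 0 ≤ u) (hu1 : u ≤ 1 / 1000)
    (h : ElimStep u q j s s' x Q) :
    ‖s'.p j - (exactRot x 0 0 * s.p j + exactRot x 0 1 * s.p (j + 1))‖ ≤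
      1400 * u * (‖s.p j‖ + ‖s.p (j + 1)‖) ∧
    ‖s'.p (j + 1) - (exactRot x 1 0 * s.p j + exactRot x 1 1 * s.p (j + 1))‖ ≤
      1400 * u * (‖s.p j‖ + ‖s.p (j + 1)‖) ∧
    ‖-(s'.p j * conj (q (j + 1))) - (exactRot x 0 0 * s.β j + exactRot x 0 1 * s.d (j + 1))‖ ≤
      1400 * u * (‖s.β j‖ + ‖s.d (j + 1)‖) := by
  have hnear := h.rot.rotNear hu hu1
  obtain ⟨b1, b2⟩ := h.super_diag.norm_sub_le hu hu1 hnear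
  obtain ⟨p₀, v, w, l, r, hp, hv, hw, hl, hr, hcorr, hkeep⟩ := h.rot_p
  obtain ⟨p1, p2⟩ := hp.norm_sub_le hu hu1 hnear
  obtain ⟨t1, ht1, hx1⟩ := h.vec_fst
  obtain ⟨t2, ht2, hx2⟩ := h.vec_snd
  have x1 := norm_sub_add_mul_le hu hu1 ht1 hx1
  have x2 := norm_sub_add_mul_le hu hu1 ht2 hx2
  have hzero := exactRot_fst x
  obtain ⟨bD, bD'⟩ := norm_le_of_rotated hu1 b1 b2
  obtain ⟨pL, pL'⟩ := norm_le_of_rotated hu1 p1 p2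
  have vb := hv.norm_le_two_mul hu1
  have wb := hw.norm_le_two_mul hu1
  have r0 := hnear.le_one 0 0
  have r1 := hnear.le_one 0 1
  rw [norm_mul] at vb wb x1 x2
  clear hx1 hx2 ht1 ht2 hp hv hw hnear b2
  generalize exactRot x 0 0 = R0 at *
  generalize exactRot x 0 1 = R1 at *
  generalize s.p j = pj at *
  generalize s.p (j + 1) = pj1 at *
  generalize s.β j = βj at *
  generalize s.d (j + 1) = dj at *
  generalize s'.p (j + 1) = pj1' at *
  generalize s'.β j = βj' at *
  generalize s'.d (j + 1) = dj' at *
  generalize conj (q (j + 1)) = qc at *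
  have c0 := norm_nonneg qc
  -- 19 = 16 + 3: the rotations of β and p contribute 16u each on their own column, and forming `x`
  -- contributes 3u on both. The exact rotation of `x` itself has first entry zero.
  have elim : ‖βj' + p₀ * qc‖ ≤
      19 * u * ((‖βj‖ + ‖dj‖) + (‖pj‖ + ‖pj1‖) * ‖qc‖) := by
    have e1 : βj' + p₀ * qc = (βj' - (R0 * βj + R1 * dj)) + (p₀ - (R0 * pj + R1 * pj1)) * qc +
        -(R0 * (x.1 - (βj + pj * qc)) + R1 * (x.2 - (dj + pj1 * qc))) := by
      linear_combination hzero
    rw [e1]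
    have e2 := mul_le_mul_of_nonneg_right p1 c0
    have e3 := mul_le_mul r0 x1 (norm_nonneg _) zero_le_one
    have e4 := mul_le_mul r1 x2 (norm_nonneg _) zero_le_one
    have e5 := norm_add_le (R0 * (x.1 - (βj + pj * qc))) (R1 * (x.2 - (dj + pj1 * qc)))
    rw [norm_mul, norm_mul] at e5
    refine norm_add₃_le.trans ?_
    rw [norm_neg, norm_mul]
    linarith
  -- Either branch bounds the dominated column by 64 times the other one, so that `elim` becomes a
  -- bound relative to the dominant column alone, with constant 19 · 65 = 1235. The remaining
  -- roundings fit into 1400.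
  by_cases hc : r < l
  · obtain ⟨z, hz, hpj⟩ := hcorr hc
    have cmp := FlSumSq.norm_add_norm_le hu hu1 hr hl hc.le
    have hD' : ‖βj'‖ + ‖dj'‖ ≤ 16 * ((‖pj‖ + ‖pj1‖) * ‖qc‖) := by
      have := mul_le_mul_of_nonneg_right pL' c0
      linarith [vb.1, wb.1]
    have elim' : ‖βj' + p₀ * qc‖ ≤ 1235 * u * (‖pj‖ + ‖pj1‖) * ‖qc‖ := by
      have := mul_le_mul_of_nonneg_left (bD.trans (mul_le_mul_of_nonneg_left hD' zero_le_four)) hu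
      linarith
    -- The correction never divides by zero: for `qc = 0` the computed left side of the test is at
    -- most 0, and the right side is nonnegative.
    have hq0 : qc ≠ 0 := by
      rintro rfl
      have hv0 : ‖v‖ ≤ 0 := by simpa using vb.1
      have hw0 : ‖w‖ ≤ 0 := by simpa using wb.1
      have h1 := (abs_le.1 (hl.abs_sub_le hu hu1)).2
      have h2 := (abs_le.1 (hr.abs_sub_le hu hu1)).1
      rw [norm_le_zero_iff.1 hv0, norm_le_zero_iff.1 hw0] at h1
      simp only [norm_zero] at h1
      have : 0 ≤ ‖βj'‖ ^ 2 + ‖dj'‖ ^ 2 := by positivity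
      nlinarith
    have hqpos : 0 < ‖qc‖ := norm_pos_iff.2 hq0
    have hz1 : ‖βj' - z * qc‖ ≤ u * ‖βj'‖ := by
      have h1 := mul_le_mul_of_nonneg_right hz.norm_sub_le c0
      rw [← norm_mul, mul_assoc, ← norm_mul, div_mul_cancel₀ _ hq0] at h1
      rwa [show βj' - z * qc = -((z - βj' / qc) * qc) by field_simp; ring, norm_neg]
    refine ⟨?_, p2.trans (by gcongr; norm_num), ?_⟩
    · refine le_of_mul_le_mul_right ?_ hqpos
      rw [← norm_mul, hpj]
      have e1 : (-z - (R0 * pj + R1 * pj1)) * qc = (βj' - z * qc) + -(βj' + p₀ * qc) +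
          (p₀ - (R0 * pj + R1 * pj1)) * qc := by ring
      rw [e1]
      refine norm_add₃_le.trans ?_
      rw [norm_neg, norm_mul]
      have e2 := mul_le_mul_of_nonneg_right p1 c0
      have e3 : u * ‖βj'‖ ≤ u * (16 * ((‖pj‖ + ‖pj1‖) * ‖qc‖)) :=
        mul_le_mul_of_nonneg_left (by linarith [norm_nonneg dj']) hu
      have : 0 ≤ u * ((‖pj‖ + ‖pj1‖) * ‖qc‖) := by positivity
      linarith
    · have e1 : -(s'.p j * qc) - (R0 * βj + R1 * dj) =
          -(βj' - z * qc) + (βj' - (R0 * βj + R1 * dj)) := by rw [hpj]; ring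
      rw [e1]
      refine (norm_add_le _ _).trans ?_
      rw [norm_neg]
      have e3 : u * ‖βj'‖ ≤ u * (4 * (‖βj‖ + ‖dj‖)) :=
        mul_le_mul_of_nonneg_left (by linarith [norm_nonneg dj']) hu
      have : 0 ≤ u * (‖βj‖ + ‖dj‖) := by positivity
      linarith
  · have cmp := FlSumSq.norm_add_norm_le hu hu1 hl hr (not_lt.1 hc)
    rw [hkeep hc]
    have hL : (‖pj‖ + ‖pj1‖) * ‖qc‖ ≤ 64 * (‖βj‖ + ‖dj‖) := by
      have := mul_le_mul_of_nonneg_right pL c0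
      linarith [vb.2, wb.2]
    refine ⟨p1.trans ?_, p2.trans ?_, ?_⟩
    · gcongr; norm_num
    · gcongr; norm_num
    · have e1 : -(p₀ * qc) - (R0 * βj + R1 * dj) =
          -(βj' + p₀ * qc) + (βj' - (R0 * βj + R1 * dj)) := by ring
      rw [e1]
      refine (norm_add_le _ _).trans ?_
      rw [norm_neg]
      have e3 := mul_le_mul_of_nonneg_left hL hu
      have : 0 ≤ u * (‖βj‖ + ‖dj‖) := by positivity
      linarith

/-- In a column where both rows come from the rank-one part, the two entries are a common multiple
of two entries of the generating vector, so the relative error of the vector is inherited unchanged.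
-/
theorem norm_scale_le {ε : ℝ} {z a b x y w : ℂ} (h : ‖z - (a * x + b * y)‖ ≤ ε * (‖x‖ + ‖y‖)) :
    ‖-(z * w) - (a * -(x * w) + b * -(y * w))‖ ≤ ε * (‖-(x * w)‖ + ‖-(y * w)‖) := by
  rw [show -(z * w) - (a * -(x * w) + b * -(y * w)) = -((z - (a * x + b * y)) * w) by ring,
    norm_neg, norm_neg, norm_neg, norm_mul, norm_mul, norm_mul, ← add_mul, ← mul_assoc]
  exact mul_le_mul_of_nonneg_right h (norm_nonneg w)

/-- The entry `(a, b)` of the matrix represented by the state after the elimination in position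
`(j, j+1)`, unless `a > j` and `a > b + 1`; here `p₀` is the initial vector `p`. -/
def elimEntry (q p₀ : ℕ → ℂ) (j : ℕ) (s : ElimState) (a b : ℕ) : ℂ :=
  if a + 1 < b ∨ (a + 1 = b ∧ j ≤ a) then -(s.p a * conj (q b))
  else if a + 1 = b then s.β a
  else if a = b then s.d a
  else if a = b + 1 then s.γ b
  else -(s.qt a * conj (p₀ b))

section elimEntry

variable {q p₀ : ℕ → ℂ} {j : ℕ} {s : ElimState} {a b : ℕ}

theorem elimEntry_upper (h : a + 1 < b ∨ (a + 1 = b ∧ j ≤ a)) :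
    elimEntry q p₀ j s a b = -(s.p a * conj (q b)) := if_pos h

theorem elimEntry_super (h : a < j) : elimEntry q p₀ j s a (a + 1) = s.β a := by
  rw [elimEntry, if_neg (by omega), if_pos rfl]

theorem elimEntry_diag : elimEntry q p₀ j s a a = s.d a := by
  rw [elimEntry, if_neg (by omega), if_neg (by omega), if_pos rfl]

theorem elimEntry_sub : elimEntry q p₀ j s (b + 1) b = s.γ b := by
  rw [elimEntry, if_neg (by omega), if_neg (by omega), if_neg (by omega), if_pos rfl]

theorem elimEntry_lower (h : b + 1 < a) :
    elimEntry q p₀ j s a b = -(s.qt a * conj (p₀ b)) := by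
  rw [elimEntry, if_neg (by omega), if_neg (by omega), if_neg (by omega), if_neg (by omega)]

end elimEntry

/-- The inductive step for a full matrix `f` of which the state knows only a part. Entries below the
subdiagonal in rows beyond the current one are unknown to the state, and `f` is unconstrained there.
-/
theorem ElimStep.exists_matrix {n : ℕ} {u : ℝ} {q p₀ : ℕ → ℂ} {j : ℕ} {s s' : ElimState}
    {x : ℂ × ℂ} {Q : Matrix (Fin 2) (Fin 2) ℂ} (hj : j + 1 < n) (hu : 0 ≤ u)
    (hu1 : u ≤ 1 / 1000) (h : ElimStep u q j s s' x Q) (hp : ∀ i, i < j → s.p i = p₀ i)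
    (f : ℕ → ℕ → ℂ)
    (hf : ∀ a b, ¬ (b + 1 < a ∧ j + 1 < a) → f a b = elimEntry q p₀ (j + 1) s a b) :
    ∃ f' : ℕ → ℕ → ℂ, (∀ a b, ¬ (b + 1 < a ∧ j < a) → f' a b = elimEntry q p₀ j s' a b) ∧
      ‖rowMatrix n (fun a (b : Fin n) => f' a b) - planeMatrix n j (exactRot x) *
          rowMatrix n (fun a (b : Fin n) => f a b)‖ ≤
        2 * (1400 * u) * ‖rowMatrix n (fun a (b : Fin n) => f a b)‖ := by
  have hnear := h.rot.rotNear hu hu1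
  obtain ⟨p1, p2, pβ⟩ := h.norm_sub_p_le hu hu1
  have weak : ∀ {c : ℝ} {z x y : ℂ}, c ≤ 1400 → ‖z‖ ≤ c * u * (‖x‖ + ‖y‖) →
      ‖z‖ ≤ 1400 * u * (‖x‖ + ‖y‖) := fun hc hz => hz.trans (by gcongr)
  have hsup := (h.super_diag.norm_sub_le hu hu1 hnear).2
  have hdiag := h.diag_sub.norm_sub_le hu hu1 hnear
  have hqt := (h.rot_qt.norm_sub_le hu hu1 hnear).1
  -- Where the state no longer stores the entry, the exact rotation of `f` is taken, so that the
  -- error vanishes there.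
  let f' : ℕ → ℕ → ℂ := fun a b =>
    if b + 1 < a ∧ j < a then
      if a = j + 1 then exactRot x 1 0 * f j b + exactRot x 1 1 * f (j + 1) b else f a b
    else elimEntry q p₀ j s' a b
  have hf' : ∀ a b, ¬ (b + 1 < a ∧ j < a) → f' a b = elimEntry q p₀ j s' a b :=
    fun a b hab => if_neg hab
  have cols : ∀ b : ℕ, ‖f' j b - (exactRot x 0 0 * f j b + exactRot x 0 1 * f (j + 1) b)‖ ≤
        1400 * u * (‖f j b‖ + ‖f (j + 1) b‖) ∧
      ‖f' (j + 1) b - (exactRot x 1 0 * f j b + exactRot x 1 1 * f (j + 1) b)‖ ≤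
        1400 * u * (‖f j b‖ + ‖f (j + 1) b‖) := by
    intro b
    rcases lt_trichotomy b (j + 1) with hb | rfl | hb
    · rcases Nat.lt_succ_iff_lt_or_eq.1 hb with hb | rfl
      · constructor
        · rcases Nat.lt_or_ge (b + 1) j with hb' | hb'
          · have k1 : f j b = -(s.qt j * conj (p₀ b)) :=
              (hf _ _ (by omega)).trans (elimEntry_lower hb')
            have k2 : f (j + 1) b = -(s.qt (j + 1) * conj (p₀ b)) :=
              (hf _ _ (by omega)).trans (elimEntry_lower (by omega))
            have k3 : f' j b = -(s'.qt j * conj (p₀ b)) :=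
              (hf' _ _ (by omega)).trans (elimEntry_lower hb')
            rw [k1, k2, k3]
            exact weak (by norm_num) (norm_scale_le hqt)
          · obtain rfl : j = b + 1 := by omega
            have k1 : f (b + 1) b = s.γ b := (hf _ _ (by omega)).trans elimEntry_sub
            have k2 : f (b + 1 + 1) b = -(s.qt (b + 1 + 1) * conj (p₀ b)) :=
              (hf _ _ (by omega)).trans (elimEntry_lower (by omega))
            have k3 : f' (b + 1) b = s'.γ b := (hf' _ _ (by omega)).trans elimEntry_sub
            rw [k1, k2, k3]
            obtain ⟨w, hw, hγ⟩ := h.sub (by omega)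
            rw [Nat.add_sub_cancel] at hw hγ
            -- The algorithm multiplies by the current p_{j-1}, which no pass has touched yet,
            -- whereas `elimEntry` uses the initial vector.
            rw [hp b hb] at hw
            exact weak (by norm_num) (hγ.norm_sub_le_of_neg_mul hu hu1 hw (hnear.near 0 0)
              (hnear.near 0 1) (hnear.le_one 0 0) (hnear.le_one 0 1))
        · have k : f' (j + 1) b = exactRot x 1 0 * f j b + exactRot x 1 1 * f (j + 1) b :=
            (if_pos (by omega)).trans (if_pos rfl)
          rw [k, sub_self, norm_zero]
          positivity
      · have k1 : f b b = s.d b := (hf _ _ (by omega)).trans elimEntry_diag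
        have k2 : f (b + 1) b = s.γ b := (hf _ _ (by omega)).trans elimEntry_sub
        have k3 : f' b b = s'.d b := (hf' _ _ (by omega)).trans elimEntry_diag
        have k4 : f' (b + 1) b = s'.γ b := (hf' _ _ (by omega)).trans elimEntry_sub
        rw [k1, k2, k3, k4]
        exact ⟨weak (by norm_num) hdiag.1, weak (by norm_num) hdiag.2⟩
    · have k1 : f j (j + 1) = s.β j := (hf _ _ (by omega)).trans (elimEntry_super (by omega))
      have k2 : f (j + 1) (j + 1) = s.d (j + 1) := (hf _ _ (by omega)).trans elimEntry_diag
      have k3 : f' j (j + 1) = -(s'.p j * conj (q (j + 1))) :=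
        (hf' _ _ (by omega)).trans (elimEntry_upper (by omega))
      have k4 : f' (j + 1) (j + 1) = s'.d (j + 1) := (hf' _ _ (by omega)).trans elimEntry_diag
      rw [k1, k2, k3, k4]
      exact ⟨pβ, weak (by norm_num) hsup⟩
    · have k1 : f j b = -(s.p j * conj (q b)) :=
        (hf _ _ (by omega)).trans (elimEntry_upper (by omega))
      have k2 : f (j + 1) b = -(s.p (j + 1) * conj (q b)) :=
        (hf _ _ (by omega)).trans (elimEntry_upper (by omega))
      have k3 : f' j b = -(s'.p j * conj (q b)) :=
        (hf' _ _ (by omega)).trans (elimEntry_upper (by omega))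
      have k4 : f' (j + 1) b = -(s'.p (j + 1) * conj (q b)) :=
        (hf' _ _ (by omega)).trans (elimEntry_upper (by omega))
      rw [k1, k2, k3, k4]
      exact ⟨norm_scale_le p1, norm_scale_le p2⟩
  refine ⟨f', hf', norm_sub_planeMatrix_mul_le hj (by positivity) _
    (fun a (b : Fin n) => f' a b) (fun a (b : Fin n) => f a b) (fun a b _ h1 h2 => ?_)
    (fun b => (cols b).1) (fun b => (cols b).2)⟩
  by_cases hab : (b : ℕ) + 1 < a ∧ j < a
  · exact (if_pos hab).trans (if_neg h2)
  · have e : (a + 1 = (b : ℕ) ∧ j ≤ a) ↔ (a + 1 = (b : ℕ) ∧ j + 1 ≤ a) := by omega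
    simp only [hf' a b hab, hf a b (by omega), elimEntry, e, h.keep_p a h1 h2, h.keep_β a h1,
      h.keep_d a h1 h2, h.keep_qt a h1 h2]
    split_ifs with h3 h4 h5 h6
    any_goals rfl
    exact h.keep_γ b (by omega) (by omega)

/-- Sequences constructed by downward recursion. -/
theorem exists_downward_seq {α : Type*} (P : ℕ → α → Prop) (r : ℕ → α → α → Prop) (N : ℕ) (f₀ : α)
    (h₀ : P N f₀) (step : ∀ j, j < N → ∀ f, P (j + 1) f → ∃ f', P j f' ∧ r j f f') :
    ∃ F : ℕ → α, F N = f₀ ∧ (∀ j, j ≤ N → P j (F j)) ∧ ∀ j, j < N → r j (F (j + 1)) (F j) := by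
  induction N generalizing f₀ with
  | zero => exact ⟨fun _ => f₀, rfl, fun j hj => by rwa [Nat.le_zero.1 hj], by simp⟩
  | succ N ih =>
    obtain ⟨f', hP, hr⟩ := step N (Nat.lt_succ_self N) f₀ h₀
    obtain ⟨F, hF, hFP, hFr⟩ := ih f' hP fun j hj => step j (by omega)
    refine ⟨fun j => if j = N + 1 then f₀ else F j, if_pos rfl, fun j hj => ?_, fun j hj => ?_⟩
    · dsimp only
      split_ifs with h
      · rwa [h]
      · exact hFP j (by omega)
    · dsimp only
      rw [if_neg (by omega : j ≠ N + 1)]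
      split_ifs with h
      · obtain rfl : j = N := by omega
        rwa [hF]
      · exact hFr j (by omega)

/-! ### One pass of the rotation back -/

/-- The entry `(a, b)`, where `b ≤ a + 1`, of the conjugate transpose of the matrix represented by
the state after the rotation of the columns `j` and `j + 1`. -/
def backEntry (γ p : ℕ → ℂ) (j : ℕ) (t : BackState) (a b : ℕ) : ℂ :=
  if a = b + 1 ∧ j ≤ b then conj (t.β b)
  else if b < a then -(t.q a * conj (p b))
  else if a = b then conj (t.d a)
  else conj (γ a)

/-- Rotating columns by the adjoint from the right is rotating rows of the conjugate transpose from
the left, so the row estimate applies again. No dominance argument is needed: each computed entry is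
a direct rotation of two entries that the state represents. -/
theorem BackStep.exists_matrix {n : ℕ} {u : ℝ} {γ p : ℕ → ℂ} {j : ℕ} {t t' : BackState}
    {Q R : Matrix (Fin 2) (Fin 2) ℂ} (hj : j + 1 < n) (hu : 0 ≤ u)
    (hu1 : u ≤ 1 / 1000) (h : BackStep u γ p Q j t t') (hnear : RotNear u Q R)
    (f : ℕ → ℕ → ℂ)
    (hf : ∀ a b, (b ≤ a ∨ (b = a + 1 ∧ a < j + 1)) → a < n → f a b = backEntry γ p (j + 1) t a b) :
    ∃ f' : ℕ → ℕ → ℂ,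
      (∀ a b, (b ≤ a ∨ (b = a + 1 ∧ a < j)) → a < n → f' a b = backEntry γ p j t' a b) ∧
      ‖rowMatrix n (fun a (b : Fin n) => f' a b) - planeMatrix n j R *
          rowMatrix n (fun a (b : Fin n) => f a b)‖ ≤
        2 * (1400 * u) * ‖rowMatrix n (fun a (b : Fin n) => f a b)‖ := by
  have weak : ∀ {c : ℝ} {z x y : ℂ}, c ≤ 1400 → ‖z‖ ≤ c * u * (‖x‖ + ‖y‖) →
      ‖z‖ ≤ 1400 * u * (‖x‖ + ‖y‖) := fun hc hz => hz.trans (by gcongr)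
  have cconj : ∀ {ε : ℝ} {z r s x y : ℂ}, ‖z - (conj r * x + conj s * y)‖ ≤ ε * (‖x‖ + ‖y‖) →
      ‖conj z - (r * conj x + s * conj y)‖ ≤ ε * (‖conj x‖ + ‖conj y‖) := by
    intro ε z r s x y hz
    rw [RCLike.norm_conj, RCLike.norm_conj]
    refine le_trans (le_of_eq ?_) hz
    rw [← RCLike.norm_conj]
    simp
  have hnear' : RotNear u (Q.map conj) (R.map conj) := by
    constructor
    · intro i k
      rw [Matrix.map_apply, Matrix.map_apply, ← map_sub, RCLike.norm_conj]
      exact hnear.near i k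
    · intro i k
      rw [Matrix.map_apply, RCLike.norm_conj]
      exact hnear.le_one i k
  have hq := h.rot_q.norm_sub_le hu hu1 hnear
  obtain ⟨w, hw, hds⟩ := h.diag_super
  have hd := cconj (hds.1.norm_sub_le_of_neg_mul hu hu1 hw (hnear'.near 0 0) (hnear'.near 0 1)
    (hnear'.le_one 0 0) (hnear'.le_one 0 1))
  have hβ := cconj (hds.2.norm_sub_le_of_neg_mul hu hu1 hw (hnear'.near 1 0) (hnear'.near 1 1)
    (hnear'.le_one 1 0) (hnear'.le_one 1 1))
  have hγ := cconj (h.sub_diag.norm_sub_le hu hu1 (hnear'.near 1 0) (hnear'.near 1 1)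
    (hnear'.le_one 1 0) (hnear'.le_one 1 1))
  have hc : conj (-(p j * conj (t.q (j + 1)))) = -(t.q (j + 1) * conj (p j)) := by
    simp [mul_comm]
  rw [hc] at hd hβ
  -- Above the diagonal of the conjugate transpose only the subdiagonal entries not yet consumed are
  -- tracked. The other entries there follow the exact rotation.
  let f' : ℕ → ℕ → ℂ := fun a b =>
    if b ≤ a ∨ (b = a + 1 ∧ a < j) then backEntry γ p j t' a b
    else if a = j then R 0 0 * f j b + R 0 1 * f (j + 1) b
    else if a = j + 1 then R 1 0 * f j b + R 1 1 * f (j + 1) b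
    else f a b
  have hf' : ∀ a b, (b ≤ a ∨ (b = a + 1 ∧ a < j)) → f' a b = backEntry γ p j t' a b :=
    fun a b hab => if_pos hab
  have ent_rank : ∀ {i : ℕ} {t : BackState} {a b : ℕ}, b < a → (b + 1 < a ∨ b < i) →
      backEntry γ p i t a b = -(t.q a * conj (p b)) := fun h1 h2 => by
    rw [backEntry, if_neg (by omega), if_pos h1]
  have ent_diag : ∀ {i : ℕ} {t : BackState} {a : ℕ}, backEntry γ p i t a a = conj (t.d a) := by
    intros
    rw [backEntry, if_neg (by omega), if_neg (by omega), if_pos rfl]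
  have cols : ∀ b : ℕ, ‖f' j b - (R 0 0 * f j b + R 0 1 * f (j + 1) b)‖ ≤
        1400 * u * (‖f j b‖ + ‖f (j + 1) b‖) ∧
      ‖f' (j + 1) b - (R 1 0 * f j b + R 1 1 * f (j + 1) b)‖ ≤
        1400 * u * (‖f j b‖ + ‖f (j + 1) b‖) := by
    intro b
    have hfree : ∀ b, j < b → ‖f' j b - (R 0 0 * f j b + R 0 1 * f (j + 1) b)‖ ≤
        1400 * u * (‖f j b‖ + ‖f (j + 1) b‖) := by
      intro b hb
      have k : f' j b = R 0 0 * f j b + R 0 1 * f (j + 1) b :=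
        (if_neg (by omega)).trans (if_pos rfl)
      rw [k, sub_self, norm_zero]
      positivity
    rcases lt_trichotomy b (j + 1) with hb | rfl | hb
    · rcases Nat.lt_succ_iff_lt_or_eq.1 hb with hb | rfl
      · have k1 : f j b = -(t.q j * conj (p b)) :=
          (hf _ _ (by omega) (by omega)).trans (ent_rank hb (by omega))
        have k2 : f (j + 1) b = -(t.q (j + 1) * conj (p b)) :=
          (hf _ _ (by omega) (by omega)).trans (ent_rank (by omega) (by omega))
        have k3 : f' j b = -(t'.q j * conj (p b)) :=
          (hf' _ _ (by omega)).trans (ent_rank hb (by omega))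
        have k4 : f' (j + 1) b = -(t'.q (j + 1) * conj (p b)) :=
          (hf' _ _ (by omega)).trans (ent_rank (by omega) (by omega))
        rw [k1, k2, k3, k4]
        exact ⟨weak (by norm_num) (norm_scale_le hq.1), weak (by norm_num) (norm_scale_le hq.2)⟩
      · have k1 : f b b = conj (t.d b) := (hf _ _ (by omega) (by omega)).trans ent_diag
        have k2 : f (b + 1) b = -(t.q (b + 1) * conj (p b)) :=
          (hf _ _ (by omega) (by omega)).trans (ent_rank (by omega) (by omega))
        have k3 : f' b b = conj (t'.d b) := (hf' _ _ (by omega)).trans ent_diag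
        have k4 : f' (b + 1) b = conj (t'.β b) :=
          (hf' _ _ (by omega)).trans (if_pos (by omega))
        rw [k1, k2, k3, k4]
        exact ⟨weak (by norm_num) hd, weak (by norm_num) hβ⟩
    · refine ⟨hfree _ (by omega), ?_⟩
      have k1 : f j (j + 1) = conj (γ j) := by
        rw [hf _ _ (by omega) (by omega), backEntry, if_neg (by omega), if_neg (by omega),
          if_neg (by omega)]
      have k2 : f (j + 1) (j + 1) = conj (t.d (j + 1)) :=
        (hf _ _ (by omega) (by omega)).trans ent_diag
      have k4 : f' (j + 1) (j + 1) = conj (t'.d (j + 1)) := (hf' _ _ (by omega)).trans ent_diag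
      rw [k1, k2, k4]
      exact weak (by norm_num) hγ
    · refine ⟨hfree _ (by omega), ?_⟩
      have k : f' (j + 1) b = R 1 0 * f j b + R 1 1 * f (j + 1) b :=
        (if_neg (by omega)).trans ((if_neg (by omega)).trans (if_pos rfl))
      rw [k, sub_self, norm_zero]
      positivity
  refine ⟨f', fun a b hab _ => hf' a b hab, norm_sub_planeMatrix_mul_le hj (by positivity) _
    (fun a (b : Fin n) => f' a b) (fun a (b : Fin n) => f a b) (fun a b ha h1 h2 => ?_)
    (fun b => (cols b).1) (fun b => (cols b).2)⟩
  by_cases hab : (b : ℕ) ≤ a ∨ ((b : ℕ) = a + 1 ∧ a < j)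
  · have e : (a = (b : ℕ) + 1 ∧ j ≤ b) ↔ (a = (b : ℕ) + 1 ∧ j + 1 ≤ b) := by omega
    simp only [hf' a b hab, hf a b (by omega) ha, backEntry, e, h.keep_d a h1 h2, h.keep_q a h1 h2]
    split_ifs with h3
    · rw [h.keep_β b (by omega)]
    all_goals rfl
  · exact (if_neg hab).trans ((if_neg h1).trans (if_neg h2))

/-! ### The whole sweep -/

/-- The accumulated bound for matrices with one column, where the Frobenius norm is the Euclidean
norm. -/
theorem norm_toLp_sub_mulVec_le {n : ℕ} {ε : ℝ} (hε : 0 ≤ ε) (hn : n * ε ≤ 1) (x : ℕ → ℂ × ℂ)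
    (v : ℕ → ℕ → ℂ)
    (h : ∀ j, j + 1 < n → ∀ a, a ≠ j → a ≠ j + 1 → v j a = v (j + 1) a)
    (h0 : ∀ j, j + 1 < n → ‖v j j - (exactRot (x j) 0 0 * v (j + 1) j +
      exactRot (x j) 0 1 * v (j + 1) (j + 1))‖ ≤ ε / 2 * (‖v (j + 1) j‖ + ‖v (j + 1) (j + 1)‖))
    (h1 : ∀ j, j + 1 < n → ‖v j (j + 1) - (exactRot (x j) 1 0 * v (j + 1) j +
      exactRot (x j) 1 1 * v (j + 1) (j + 1))‖ ≤ ε / 2 * (‖v (j + 1) j‖ + ‖v (j + 1) (j + 1)‖))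
    (w : Fin n → ℂ) (hw : v (n - 1) = arr w) :
    ‖WithLp.toLp 2 ((fun i : Fin n => v 0 i) -
        planeProduct n (fun j => exactRot (x j)) *ᵥ w)‖ ≤ 2 * n * ε * ‖WithLp.toLp 2 w‖ := by
  have key := norm_sub_planeProduct_mul_le hε hn x
    (fun j => rowMatrix n (fun a (_ : Unit) => v j a)) fun j hj => by
      have := norm_sub_planeMatrix_mul_le hj (by positivity : (0 : ℝ) ≤ ε / 2) (exactRot (x j))
        (fun a (_ : Unit) => v j a) (fun a (_ : Unit) => v (j + 1) a)
        (fun a _ _ h2 h3 => h j hj a h2 h3) (fun _ => h0 j hj) (fun _ => h1 j hj)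
      rwa [mul_div_cancel₀ ε two_ne_zero] at this
  have e1 : rowMatrix n (fun a (_ : Unit) => v (n - 1) a) = Matrix.replicateCol Unit w := by
    ext a b
    simp [rowMatrix, hw, arr]
  have e0 : rowMatrix n (fun a (_ : Unit) => v 0 a) =
    Matrix.replicateCol Unit (fun i : Fin n => v 0 i) := rfl
  rw [e0, e1, ← Matrix.replicateCol_mulVec] at key
  rwa [← Matrix.frobenius_norm_replicateCol (ι := Unit),
    ← Matrix.frobenius_norm_replicateCol (ι := Unit)]

section Run

variable {u : ℝ} {n : ℕ} {A : Matrix (Fin n) (Fin n) ℂ} {p q : Fin n → ℂ} {S : ℕ → ElimState}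
  {x : ℕ → ℂ × ℂ} {Q : ℕ → Matrix (Fin 2) (Fin 2) ℂ} {T : ℕ → BackState}

/-- The entries of `p` that have not been reached by the elimination are unchanged. -/
theorem ElimRun.p_eq (h : ElimRun u A p q S x Q) (k : ℕ) :
    ∀ j, j + k = n - 1 → ∀ i, i < j → (S j).p i = arr p i := by
  induction k with
  | zero =>
    rintro j hj i -
    obtain rfl : j = n - 1 := hj
    rw [h.init]; rfl
  | succ k ih =>
    intro j hj i hi
    rw [(h.step j (by omega)).keep_p i (by omega) (by omega)]
    exact ih (j + 1) (by omega) i (by omega)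

/-- The matrix represented by the initial generators is `A`. -/
theorem rowMatrix_elimInit (hA : A.IsHermitian)
    (hH : IsLowerHessenberg (A + Matrix.vecMulVec p (star q))) :
    rowMatrix n (fun a (b : Fin n) => elimEntry (arr q) (arr p) (n - 1) (elimInit A p q) a b) =
      A := by
  have up : ∀ a b : Fin n, (a : ℕ) + 1 < b → A a b = -(p a * conj (q b)) := by
    intro a b hab
    have := hH a b hab
    rw [Matrix.add_apply, Matrix.vecMulVec_apply] at this
    exact eq_neg_of_add_eq_zero_left this
  ext ⟨a, ha⟩ ⟨b, hb⟩
  simp only [rowMatrix, Matrix.of_apply]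
  rcases lt_trichotomy a b with hab | rfl | hab
  · rcases Nat.lt_or_ge (a + 1) b with h | h
    · rw [elimEntry_upper (Or.inl h), up ⟨a, ha⟩ ⟨b, hb⟩ h]
      simp [elimInit, arr, ha, hb]
    · obtain rfl : b = a + 1 := by omega
      rw [elimEntry_super (by omega)]
      simp [elimInit, superdiagArr, hb]
  · rw [elimEntry_diag]
    simp [elimInit, diagArr, ha]
  · rcases Nat.lt_or_ge (b + 1) a with h | h
    · rw [elimEntry_lower h, ← hA.apply, up ⟨b, hb⟩ ⟨a, ha⟩ h]
      simp [elimInit, arr, ha, hb, mul_comm]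
    · obtain rfl : a = b + 1 := by omega
      rw [elimEntry_sub, ← hA.apply]
      simp [elimInit, superdiagArr, ha]

/-- The error of the elimination: the upper triangle and the subdiagonal of a matrix close to `U A`
are given by the outputs. -/
theorem ElimRun.exists_matrix (hu : 0 ≤ u) (hu1 : u ≤ 1 / 1000) (hn : n * (2 * (1400 * u)) ≤ 1)
    (hA : A.IsHermitian) (hH : IsLowerHessenberg (A + Matrix.vecMulVec p (star q)))
    (h : ElimRun u A p q S x Q) :
    ∃ f : ℕ → ℕ → ℂ, (∀ a b, a ≤ b + 1 → f a b = elimEntry (arr q) (arr p) 0 (S 0) a b) ∧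
      ‖rowMatrix n (fun a (b : Fin n) => f a b) -
          planeProduct n (fun j => exactRot (x j)) * A‖ ≤
        2 * n * (2 * (1400 * u)) * ‖A‖ := by
  obtain ⟨F, hF, hFP, hFr⟩ := exists_downward_seq
    (fun j f => ∀ a b, ¬ (b + 1 < a ∧ j < a) → f a b = elimEntry (arr q) (arr p) j (S j) a b)
    (fun j (f f' : ℕ → ℕ → ℂ) => ‖rowMatrix n (fun a (b : Fin n) => f' a b) -
      planeMatrix n j (exactRot (x j)) * rowMatrix n (fun a (b : Fin n) => f a b)‖ ≤
        2 * (1400 * u) * ‖rowMatrix n (fun a (b : Fin n) => f a b)‖) (n - 1)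
    (elimEntry (arr q) (arr p) (n - 1) (S (n - 1))) (fun a b _ => rfl)
    (fun j hj f hf => (h.step j (by omega)).exists_matrix (by omega) hu hu1
      (fun i hi => h.p_eq (n - 1 - (j + 1)) (j + 1) (by omega) i (by omega)) f hf)
  refine ⟨F 0, fun a b hab => hFP 0 (Nat.zero_le _) a b (by omega), ?_⟩
  have key := norm_sub_planeProduct_mul_le (by positivity) hn x
    (fun j => rowMatrix n (fun a (b : Fin n) => F j a b)) fun j hj => hFr j (by omega)
  have e : rowMatrix n (fun a (b : Fin n) => F (n - 1) a b) = A := by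
    rw [hF, h.init]
    exact rowMatrix_elimInit hA hH
  rwa [e] at key

/-- The error of the rotation back: the upper triangle of a matrix close to `B Uᴴ` is given by the
outputs, if the upper triangle and the subdiagonal of `B` are given by the inputs. -/
theorem BackRun.exists_matrix {d γ p q : ℕ → ℂ} (hu : 0 ≤ u) (hu1 : u ≤ 1 / 1000)
    (hn : n * (2 * (1400 * u)) ≤ 1) (h : BackRun u n d γ p q Q T)
    (hQ : ∀ j, j + 1 < n → RotNear u (Q j) (exactRot (x j))) (g : ℕ → ℕ → ℂ)
    (hup : ∀ a b, a < b → g a b = -(p a * conj (q b))) (hdiag : ∀ a, g a a = d a)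
    (hsub : ∀ a, g (a + 1) a = γ a) :
    ∃ f : ℕ → ℕ → ℂ, (∀ a b, b ≤ a → a < n → f a b = backEntry γ p 0 (T 0) a b) ∧
      ‖rowMatrix n (fun a (b : Fin n) => f a b) - planeProduct n (fun j => exactRot (x j)) *
          (rowMatrix n (fun a (b : Fin n) => g a b))ᴴ‖ ≤
        2 * n * (2 * (1400 * u)) * ‖(rowMatrix n (fun a (b : Fin n) => g a b))ᴴ‖ := by
  obtain ⟨F, hF, hFP, hFr⟩ := exists_downward_seq
    (fun j f => ∀ a b, (b ≤ a ∨ (b = a + 1 ∧ a < j)) → a < n →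
      f a b = backEntry γ p j (T j) a b)
    (fun j (f f' : ℕ → ℕ → ℂ) => ‖rowMatrix n (fun a (b : Fin n) => f' a b) -
      planeMatrix n j (exactRot (x j)) * rowMatrix n (fun a (b : Fin n) => f a b)‖ ≤
        2 * (1400 * u) * ‖rowMatrix n (fun a (b : Fin n) => f a b)‖) (n - 1)
    (fun a b => conj (g b a)) (fun a b hab ha => by
      dsimp only
      -- `a < n` rules out the branch that reads β, whose initial content is arbitrary.
      rw [backEntry, if_neg (by omega)]
      split_ifs with h1 h2
      · rw [hup b a h1, h.init_q]
        simp [mul_comm]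
      · rw [h2, hdiag, h.init_d]
      · obtain rfl : b = a + 1 := by omega
        rw [hsub])
    (fun j hj f hf => (h.step j (by omega)).exists_matrix (by omega) hu hu1
      (hQ j (by omega)) f hf)
  refine ⟨F 0, fun a b hab ha => hFP 0 (Nat.zero_le _) a b (Or.inl hab) ha, ?_⟩
  have key := norm_sub_planeProduct_mul_le (by positivity) hn x
    (fun j => rowMatrix n (fun a (b : Fin n) => F j a b)) fun j hj => hFr j (by omega)
  rw [hF] at key
  exact key

end Run

end HermRankOneQR

/-! ### Combination of the two algorithms into the three bounds -/

open HermRankOneQR in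
theorem theorem4p1 :
    ∃ K : ℝ, 0 < K ∧
      ∀ (n : ℕ) (u : ℝ) (A : Matrix (Fin n) (Fin n) ℂ) (p q : Fin n → ℂ)
        (S : ℕ → ElimState) (x : ℕ → ℂ × ℂ) (Qhat : ℕ → Matrix (Fin 2) (Fin 2) ℂ)
        (T : ℕ → BackState),
        0 ≤ u → K * (n : ℝ) ^ 3 * u ≤ 1 →
        A.IsHermitian →
        IsLowerHessenberg (A + Matrix.vecMulVec p (star q)) →
        ElimRun u A p q S x Qhat →
        BackRun u n (S 0).d (S 0).γ (S 0).p (arr q) Qhat T →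
        let U : Matrix (Fin n) (Fin n) ℂ := planeProduct n fun j => exactRot (x j)
        let Ahat : Matrix (Fin n) (Fin n) ℂ := generatedMatrix n (T 0).d (T 0).β (S 0).p (T 0).q
        let phat : Fin n → ℂ := fun i => (S 0).p i
        let qhat : Fin n → ℂ := fun i => (T 0).q i
        ‖Ahat - U * A * Uᴴ‖ ≤ K * (n : ℝ) ^ 3 * ‖A‖ * u ∧
        ‖WithLp.toLp 2 (phat - U *ᵥ p)‖ ≤ K * (n : ℝ) ^ 3 * ‖WithLp.toLp 2 p‖ * u ∧
        ‖WithLp.toLp 2 (qhat - U *ᵥ q)‖ ≤ K * (n : ℝ) ^ 3 * ‖WithLp.toLp 2 q‖ * u := by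
  refine ⟨100000, by norm_num, fun n u A p q S x Qhat T hu hK hA hH hE hB => ?_⟩
  intro U Ahat phat qhat
  -- For `n = 0` the smallness assumption says nothing about `u`, but everything is empty.
  rcases Nat.eq_zero_or_pos n with rfl | hpos
  · have h1 : Ahat - U * A * Uᴴ = 0 := Subsingleton.elim _ _
    have h2 : phat - U *ᵥ p = 0 := Subsingleton.elim _ _
    have h3 : qhat - U *ᵥ q = 0 := Subsingleton.elim _ _
    rw [h1, h2, h3]
    simp
  have hn1 : (1 : ℝ) ≤ n := by exact_mod_cast hpos
  have hn3 : (n : ℝ) ≤ (n : ℝ) ^ 3 := by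
    simpa using pow_le_pow_right₀ hn1 (show 1 ≤ 3 by norm_num)
  have hnu : (n : ℝ) * u ≤ (n : ℝ) ^ 3 * u := mul_le_mul_of_nonneg_right hn3 hu
  have hu1 : u ≤ 1 / 1000 := by
    have := mul_le_mul_of_nonneg_right hn1 hu
    linarith
  have hn : n * (2 * (1400 * u)) ≤ 1 := by linarith
  have hε : 0 ≤ 2 * (1400 * u) := by positivity
  have bound : ∀ {y : ℝ} {c : ℝ}, 0 ≤ y → c ≤ 100000 →
      c * n * u * y ≤ 100000 * (n : ℝ) ^ 3 * y * u := by
    intro y c hy hc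
    have h1 : c * (n * u) ≤ 100000 * ((n : ℝ) ^ 3 * u) := by gcongr
    have := mul_le_mul_of_nonneg_right h1 hy
    linarith
  have hnear : ∀ j, j + 1 < n → RotNear u (Qhat j) (exactRot (x j)) :=
    fun j hj => (hE.step j hj).rot.rotNear hu hu1
  refine ⟨?_, ?_, ?_⟩
  · obtain ⟨g, hg, hgA⟩ := hE.exists_matrix hu hu1 hn hA hH
    obtain ⟨f, hf, hfg⟩ := hB.exists_matrix hu hu1 hn hnear g
      (fun a b hab => (hg a b (by omega)).trans (elimEntry_upper (by omega)))
      (fun a => (hg a a (by omega)).trans elimEntry_diag)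
      (fun a => (hg _ _ le_rfl).trans elimEntry_sub)
    rw [Matrix.frobenius_norm_conjTranspose] at hfg
    set B := rowMatrix n (fun a (b : Fin n) => g a b)
    set N := rowMatrix n (fun a (b : Fin n) => f a b)
    change ‖B - U * A‖ ≤ _ at hgA
    change ‖N - U * Bᴴ‖ ≤ _ at hfg
    have hUA : ‖U * A‖ ≤ ‖A‖ := planeProduct_mul_norm_le x A
    have hB2 : ‖B‖ ≤ 2 * ‖A‖ := by
      have h1 := norm_add_err hgA
      have h2 : n * (2 * (1400 * u)) ≤ 1 / 2 := by linarith
      have := mul_le_mul_of_nonneg_right h2 (norm_nonneg A)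
      linarith
    have herm : (U * A * Uᴴ).IsHermitian := Matrix.isHermitian_mul_mul_conjTranspose U hA
    have e1 : ‖U * (Bᴴ - (U * A)ᴴ)‖ ≤ ‖B - U * A‖ := by
      refine (planeProduct_mul_norm_le x _).trans ?_
      rw [← Matrix.conjTranspose_sub, Matrix.frobenius_norm_conjTranspose]
    -- The two error sources separate: that of the rotation back, and that of the elimination
    -- carried through `U`. The term U(UA)ᴴ is the adjoint of UAUᴴ.
    have e2 : Nᴴ - U * A * Uᴴ = ((N - U * Bᴴ) + U * (Bᴴ - (U * A)ᴴ))ᴴ := by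
      rw [Matrix.mul_sub, sub_add_sub_cancel, Matrix.conjTranspose_sub, Matrix.conjTranspose_mul,
        Matrix.conjTranspose_conjTranspose]
    -- 5600nu‖A‖ from the elimination plus 5600nu‖B‖ ≤ 11200nu‖A‖ from the rotation back.
    have e3 : ‖Nᴴ - U * A * Uᴴ‖ ≤ 16800 * n * u * ‖A‖ := by
      rw [e2, Matrix.frobenius_norm_conjTranspose]
      refine (norm_add_le _ _).trans ?_
      have := mul_le_mul_of_nonneg_left hB2 (by positivity : 0 ≤ 2 * n * (2 * (1400 * u)))
      linarith
    -- Only the upper triangle of Nᴴ is given by the outputs. The computed diagonal need not be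
    -- real, so symmetry is used off the diagonal only.
    have e4 : ‖Ahat - U * A * Uᴴ‖ ≤ 2 * ‖Nᴴ - U * A * Uᴴ‖ := by
      refine norm_sub_le_of_upper herm (fun a b hab => ?_) (fun a b hab => ?_)
      · have hab' : (a : ℕ) < b := hab
        simp only [Ahat, generatedMatrix, Matrix.of_apply]
        split_ifs <;> first | omega | simp [mul_comm]
      · have hab' : (a : ℕ) ≤ b := hab
        rw [Matrix.conjTranspose_apply]
        simp only [Ahat, generatedMatrix, N, rowMatrix, Matrix.of_apply, hf b a hab' b.2, backEntry]
        split_ifs with c1 c2 c3 <;> first | omega | simp [mul_comm, *]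
    refine (e4.trans (mul_le_mul_of_nonneg_left e3 zero_le_two)).trans ?_
    rw [← mul_assoc, ← mul_assoc, ← mul_assoc]
    exact bound (norm_nonneg A) (by norm_num)
  · have key := norm_toLp_sub_mulVec_le hε hn x (fun j => (S j).p)
      (fun j hj a h1 h2 => (hE.step j hj).keep_p a h1 h2)
      (fun j hj => by
        rw [mul_div_cancel_left₀ _ two_ne_zero]
        exact ((hE.step j hj).norm_sub_p_le hu hu1).1)
      (fun j hj => by
        rw [mul_div_cancel_left₀ _ two_ne_zero]
        exact ((hE.step j hj).norm_sub_p_le hu hu1).2.1) p (by rw [hE.init]; rfl)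
    refine (key.trans (le_of_eq ?_)).trans (bound (c := 5600) (norm_nonneg _) (by norm_num))
    ring
  · have key := norm_toLp_sub_mulVec_le hε hn x (fun j => (T j).q)
      (fun j hj a h1 h2 => (hB.step j hj).keep_q a h1 h2)
      (fun j hj => by
        rw [mul_div_cancel_left₀ _ two_ne_zero]
        refine ((hB.step j hj).rot_q.norm_sub_le hu hu1 (hnear j hj)).1.trans ?_
        gcongr; norm_num)
      (fun j hj => by
        rw [mul_div_cancel_left₀ _ two_ne_zero]
        refine ((hB.step j hj).rot_q.norm_sub_le hu hu1 (hnear j hj)).2.trans ?_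
        gcongr; norm_num) q hB.init_q
    refine (key.trans (le_of_eq ?_)).trans (bound (c := 5600) (norm_nonneg _) (by norm_num))
    ring
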